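/- Let $k$ be a field. A connected graded algebra is an associative $k$-algebra $A=\bigoplus_{i\ge 0}A_i$ graded by the non-negative integers with $A_0=k$; graded modules $M=\bigoplus_{i\in\mathbb Z}M_i$ are right modules, and the Hilbert series of a graded space $V$ with finite-dimensional components is $V(z)=\sum_i(\dim_k V_i)z^i$. For a graded right $A$-module $M$ and $i\ge 0$ put $m_i(M)=\sup\{j : \operatorname{Tor}_i^A(M,k)_j\neq 0\}$, with $m_i(M)=0$ if $\operatorname{Tor}_i^A(M,k)=0$, and put $m_i(A)=m_i(k_A)$, where $k_A$ is the trivial module $k$ in degree $0$; thus $m_i(A)=\sup\{j : \operatorname{Tor}_i^A(k,k)_j\ne 0\}$. Let $n,a,b,c,m,p_1,p_2,q,r$ be nine integers. (a) Let $D(n,a,b,c)$ be the class of all connected graded algebras $A$ over $k$ with at most $n$ generators such that $m_1(A)\le a$, $m_2(A)\le b$ and $m_3(A)\le c$. Then all homogeneous components of algebras in $D(n,a,b,c)$ are finite-dimensional, and the set of Hilbert series of algebras in $D(n,a,b,c)$ is finite. (b) Let $DM(n,a,b,c,m,p_1,p_2,q,r)$ be the class of all graded right modules $M$ over algebras from $D(n,a,b,c)$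 with at most $m$ generators such that $M_i=0$ for $i<p_1$, $m_0(M)\le p_2$, $m_1(M)\le q$ and $m_2(M)\le r$. Then all homogeneous components of modules in this class are finite-dimensional, and the set of Hilbert series of modules in this class is finite. -/

import Mathlib

open scoped TensorProduct

universe u

noncomputable section

/-- A connected `ℤ₊`-graded associative algebra `A = A₀ ⊕ A₁ ⊕ A₂ ⊕ ⋯` over the field `k`,
where connected means `A₀ = k`. -/
structure ConnGradedAlgebra (k : Type u) [Field k] where
  carrier : Type u
  [ring : Ring carrier]
  [algebra : Algebra k carrier]
  /-- the homogeneous component `A i` -/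
  deg : ℕ → Submodule k carrier
  [graded : GradedAlgebra deg]
  connected : Function.Bijective (algebraMap k (deg 0))

attribute [instance] ConnGradedAlgebra.ring ConnGradedAlgebra.algebra ConnGradedAlgebra.graded

namespace ConnGradedAlgebra

variable {k : Type u} [Field k] (A : ConnGradedAlgebra k)

/-- The augmentation `A → A₀ = k`. -/
def aug : A.carrier →+* k :=
  (RingEquiv.ofBijective (algebraMap k (A.deg 0)) A.connected).symm.toRingHom.comp
    (GradedRing.projZeroRingHom' A.deg)

theorem aug_algebraMap (c : k) : A.aug (algebraMap k A.carrier c) = c := by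
  have h : GradedRing.projZeroRingHom' A.deg (algebraMap k A.carrier c)
      = algebraMap k (A.deg 0) c := by
    apply Subtype.ext
    exact DirectSum.decompose_of_mem_same A.deg (algebraMap k (A.deg 0) c).2
  simp only [aug, RingHom.comp_apply, h]
  exact (RingEquiv.ofBijective (algebraMap k (A.deg 0)) A.connected).symm_apply_apply c

theorem aug_smul (c : k) (x : A.carrier) : A.aug (c • x) = c * A.aug x := by
  rw [Algebra.smul_def, map_mul, aug_algebraMap]

theorem aug_of_mem {j : ℕ} (hj : j ≠ 0) {x : A.carrier} (hx : x ∈ A.deg j) : A.aug x = 0 := by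
  have h : GradedRing.projZeroRingHom' A.deg x = 0 := by
    apply Subtype.ext
    exact DirectSum.decompose_of_mem_ne A.deg hx hj
  simp only [aug, RingHom.comp_apply, h, map_zero]

/-- The augmentation ideal `A₊ = A₁ ⊕ A₂ ⊕ ⋯`, that is, the kernel of the augmentation. -/
def plus : Submodule k A.carrier where
  carrier := {x | A.aug x = 0}
  add_mem' := by
    intro x y hx hy
    simp only [Set.mem_ofPred_eq] at hx hy ⊢
    rw [map_add, hx, hy, add_zero]
  zero_mem' := map_zero _
  smul_mem' := by
    intro c x hx
    simp only [Set.mem_ofPred_eq] at hx ⊢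
    rw [aug_smul, hx, mul_zero]

/-- The multiplication `A₊ × A₊ → A₊`. -/
def plusMul : A.plus →ₗ[k] A.plus →ₗ[k] A.plus :=
  LinearMap.mk₂ k
    (fun x y => ⟨x.1 * y.1, by
      have hx : A.aug x.1 = 0 := x.2
      change A.aug (x.1 * y.1) = 0
      rw [map_mul, hx, zero_mul]⟩)
    (fun x y z => Subtype.ext (add_mul x.1 y.1 z.1))
    (fun c x y => Subtype.ext (smul_mul_assoc c x.1 y.1))
    (fun x y z => Subtype.ext (mul_add x.1 y.1 z.1))
    (fun c x y => Subtype.ext (mul_smul_comm c x.1 y.1))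

/-- The Hilbert series `A(z) = ∑ (dim A_i) z^i`. -/
def hilbertSeries : PowerSeries ℤ :=
  PowerSeries.mk fun i => (Module.finrank k (A.deg i) : ℤ)

/-- `A` is generated, as a `k`-algebra, by at most `n` elements. -/
def GeneratedByAtMost (n : ℤ) : Prop :=
  ∃ S : Finset A.carrier, (S.card : ℤ) ≤ n ∧ Algebra.adjoin k (S : Set A.carrier) = ⊤

end ConnGradedAlgebra

/-- A `ℤ`-graded right module `M = ⨁ M_i` over the connected graded algebra `A`. A right `A`-module
is a module over the opposite ring: `m a` is written `MulOpposite.op a • m`. -/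
structure GradedRightModule {k : Type u} [Field k] (A : ConnGradedAlgebra k) where
  carrier : Type u
  [addCommGroup : AddCommGroup carrier]
  [module : Module k carrier]
  [rightModule : Module (A.carrier)ᵐᵒᵖ carrier]
  [isScalarTower : IsScalarTower k (A.carrier)ᵐᵒᵖ carrier]
  /-- the homogeneous component `M i` -/
  deg : ℤ → Submodule k carrier
  [decomposition : DirectSum.Decomposition deg]
  smul_mem : ∀ (i : ℤ) (j : ℕ) (x : carrier) (a : A.carrier),
    x ∈ deg i → a ∈ A.deg j → MulOpposite.op a • x ∈ deg (i + j)

attribute [instance] GradedRightModule.addCommGroup GradedRightModule.module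
  GradedRightModule.rightModule GradedRightModule.isScalarTower GradedRightModule.decomposition

namespace GradedRightModule

variable {k : Type u} [Field k] {A : ConnGradedAlgebra k} (M : GradedRightModule A)

/-- The right action `M × A₊ → M`. -/
def act : M.carrier →ₗ[k] A.plus →ₗ[k] M.carrier :=
  LinearMap.mk₂ k (fun x a => MulOpposite.op a.1 • x)
    (fun x y a => smul_add (MulOpposite.op a.1) x y)
    (fun c x a => by
      rw [← smul_one_smul (A.carrier)ᵐᵒᵖ c x, smul_smul, mul_smul_comm, mul_one, smul_assoc])
    (fun x a b => by
      rw [← add_smul]; rfl)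
    (fun c x a => by
      rw [← smul_assoc]; rfl)

/-- The spaces `M ⊗ A₊ ⊗ ⋯ ⊗ A₊` (with `n` factors `A₊`) of the normalized bar complex. -/
def bar : ℕ → ModuleCat.{u} k
  | 0 => ModuleCat.of k M.carrier
  | n + 1 => ModuleCat.of k (bar n ⊗[k] A.plus)

/-- The passage from one bar differential to the next: for `d : X ⊗ A₊ → X`, the map
`x ⊗ a ⊗ b ↦ d (x ⊗ a) ⊗ b + s x ⊗ a b`, where `s` is a sign. -/
def barStep (A : ConnGradedAlgebra k) {X : Type u} [AddCommGroup X] [Module k X] (s : k)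
    (d : X ⊗[k] A.plus →ₗ[k] X) : (X ⊗[k] A.plus) ⊗[k] A.plus →ₗ[k] X ⊗[k] A.plus :=
  d.rTensor A.plus + s • ((TensorProduct.lift A.plusMul).lTensor X ∘ₗ
    (TensorProduct.assoc k X A.plus A.plus).toLinearMap)

/-- The differential of the normalized bar complex, given by `d (x ⊗ a) = x a` on `M ⊗ A₊` and
`d (y ⊗ a ⊗ b) = d (y ⊗ a) ⊗ b + (-1)^(n+1) y ⊗ a b` for `y` in `M ⊗ A₊ ⊗ ⋯ ⊗ A₊` (`n` factors
`A₊`); so `d (x ⊗ a₁ ⊗ ⋯ ⊗ aₙ)` is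
`x a₁ ⊗ a₂ ⊗ ⋯ ⊗ aₙ + ∑ (-1)^l x ⊗ a₁ ⊗ ⋯ ⊗ a_l a_(l+1) ⊗ ⋯ ⊗ aₙ`, the sum over `0 < l < n`. -/
def barD : (n : ℕ) → M.bar (n + 1) →ₗ[k] M.bar n
  | 0 => (TensorProduct.lift M.act : M.carrier ⊗[k] A.plus →ₗ[k] M.carrier)
  | n + 1 => barStep A (X := M.bar n) ((-1) ^ (n + 1)) (barD n)

/-- The space of `n`-cycles: the kernel of the differential going out of the `n`-th space of the
bar complex, which is everything for `n = 0`. -/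
def barCycles : (n : ℕ) → Submodule k (M.bar n)
  | 0 => ⊤
  | n + 1 => LinearMap.ker (M.barD n)

/-- The homogeneous component of degree `j` of the `n`-th space of the bar complex: it is spanned
by the `x ⊗ a₁ ⊗ ⋯ ⊗ aₙ` with homogeneous factors whose degrees add up to `j`. -/
def barDeg : (n : ℕ) → ℤ → Submodule k (M.bar n)
  | 0, j => M.deg j
  | n + 1, j =>
    (⨆ l : ℕ, Submodule.map₂ (TensorProduct.mk k (M.bar n) A.plus)
      (barDeg n (j - l)) ((A.deg l).comap A.plus.subtype) :
      Submodule k (M.bar n ⊗[k] A.plus))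

/-- `Tor_i^A(M, k)_j`: the `i`-th homology of the bar complex in degree `j`, that is, the
`i`-cycles of degree `j` modulo the boundaries of the chains of degree `j`. -/
abbrev Tor (i : ℕ) (j : ℤ) : Type u :=
  ↥(M.barCycles i ⊓ M.barDeg i j) ⧸
    ((M.barDeg (i + 1) j).map (M.barD i)).comap (M.barCycles i ⊓ M.barDeg i j).subtype

open Classical in
/-- `m_i(M) = sup {j | Tor_i^A(M, k)_j ≠ 0}`, an element of `ℤ ∪ {∞}` (as an extended real),
with `m_i(M) = 0` if `Tor_i^A(M, k) = 0`. -/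
def m (i : ℕ) : EReal :=
  if ∀ j : ℤ, Subsingleton (M.Tor i j) then 0
  else sSup {x : EReal | ∃ j : ℤ, Nontrivial (M.Tor i j) ∧ x = ((j : ℝ) : EReal)}

/-- The Hilbert series `M(z) = ∑ (dim M_i) z^i`, a formal sum over all `i` in `ℤ`, given by the
family of its coefficients. -/
def hilbertSeries : ℤ → ℤ :=
  fun i => (Module.finrank k (M.deg i) : ℤ)

/-- `M` is generated, as a right `A`-module, by at most `n` elements. -/
def GeneratedByAtMost (n : ℤ) : Prop :=
  ∃ S : Finset M.carrier, (S.card : ℤ) ≤ n ∧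
    Submodule.span (A.carrier)ᵐᵒᵖ (S : Set M.carrier) = ⊤

end GradedRightModule

namespace ConnGradedAlgebra

variable {k : Type u} [Field k] (A : ConnGradedAlgebra k)

/-- The one-dimensional right module `k = A / A₊`, placed in degree `0`, on which `A` acts through
the augmentation. -/
def trivialModule : GradedRightModule A where
  carrier := k
  rightModule := Module.compHom k (A.aug.fromOpposite fun x y => mul_comm (A.aug x) (A.aug y))
  isScalarTower := by
    let := Module.compHom k (A.aug.fromOpposite fun x y => mul_comm (A.aug x) (A.aug y))
    refine ⟨fun c a y => ?_⟩
    change A.aug (c • a.unop) * y = c * (A.aug a.unop * y)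
    rw [aug_smul, mul_assoc]
  deg i := if i = 0 then ⊤ else ⊥
  decomposition := DirectSum.Decomposition.ofLinearMap _
    (DirectSum.lof k ℤ (fun i : ℤ => ↥(if i = 0 then ⊤ else ⊥ : Submodule k k)) 0 ∘ₗ
      (LinearMap.id.codRestrict _ fun x => by simp))
    (by
      ext
      simp)
    (by
      ext i x
      by_cases hi : i = 0
      · subst hi
        simp
        rfl
      · have hx : x = 0 := by
          apply Subtype.ext
          have h : ∀ y ∈ (if i = 0 then ⊤ else ⊥ : Submodule k k), y = 0 := by
            rw [if_neg hi]
            exact fun y hy => hy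
          exact h _ x.2
        subst hx
        simp)
  smul_mem := by
    let := Module.compHom k (A.aug.fromOpposite fun x y => mul_comm (A.aug x) (A.aug y))
    intro i j x a hx ha
    change A.aug a * x ∈ _
    by_cases hi : i = 0
    · by_cases hj : j = 0
      · simp [hi, hj]
      · rw [aug_of_mem A hj ha, zero_mul]
        exact Submodule.zero_mem _
    · rw [if_neg hi] at hx
      have hx' : x = 0 := hx
      rw [hx', mul_zero]
      exact Submodule.zero_mem _

/-- `m_i(A) = sup {j | Tor_i^A(k, k)_j ≠ 0}` (and `0` if `Tor_i^A(k, k) = 0`). -/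
def m (i : ℕ) : EReal := A.trivialModule.m i

end ConnGradedAlgebra

/-- The class `D(n, a, b, c)` of all connected graded algebras `A` over `k` with at most `n`
generators such that `m_1(A) ≤ a`, `m_2(A) ≤ b` and `m_3(A) ≤ c`. -/
def classD (k : Type u) [Field k] (n a b c : ℤ) : Set (ConnGradedAlgebra k) :=
  {A | A.GeneratedByAtMost n ∧ A.m 1 ≤ ((a : ℝ) : EReal) ∧ A.m 2 ≤ ((b : ℝ) : EReal) ∧
    A.m 3 ≤ ((c : ℝ) : EReal)}

/-- The class `DM(n, a, b, c, m, p₁, p₂, q, r)` of all graded right modules `M` over algebras from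
`D(n, a, b, c)` with at most `m` generators such that `M_i = 0` for `i < p₁`, `m_0(M) ≤ p₂`,
`m_1(M) ≤ q` and `m_2(M) ≤ r`. -/
def classDM (k : Type u) [Field k] (n a b c m p₁ p₂ q r : ℤ) :
    Set (Σ A : ConnGradedAlgebra k, GradedRightModule A) :=
  {X | X.1 ∈ classD k n a b c ∧ X.2.GeneratedByAtMost m ∧ (∀ i < p₁, X.2.deg i = ⊥) ∧
    X.2.m 0 ≤ ((p₂ : ℝ) : EReal) ∧ X.2.m 1 ≤ ((q : ℝ) : EReal) ∧ X.2.m 2 ≤ ((r : ℝ) : EReal)}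

end

/-! The bounds on `Tor` say that bar complexes are exact above some degree `N`. Since `Tor_{i+1}(k,
k) = Tor_i(A₊, k)`, an algebra is treated as its module `A₊`, and both halves rest on one argument
about modules `M` whose bar complex is exact at places 0, 1 and 2 above `N`.

Exactness at 0 bounds the degrees of generators, so all the algebras are quotients of one free
algebra `T` and all the modules are quotients of one free `T`-module `F`, both with
finite-dimensional components (the two lemmas `exists_universal_cover`). Exactness at 1 says that
relations above degree `N` come from lower ones (`ker_inf_deg`).

The class itself serves as parameter set `P`. Finitely many functions `P → k` generate an algebra
`S` for which the relations in degrees up to `N` are filled by values of regular sections, and by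
`ker_inf_deg` this propagates to all degrees. The dimension of such a family is lower semicontinuous
(`RegularFamily.exists_le_finrank`).

In degree `d`, `dim M_d` is a constant minus the dimension of the preimage in `F ⊗ T₊` of the
boundaries of `M ⊗ A₊` (`finrank_deg_add`). Exactness at 2 expresses the sum of that dimension and
its analogue one place further by `dim (M ⊗ A₊)_d`, which involves only lower degrees of `M`
(`finrank_preBoundary_add`). Two lower semicontinuous functions with constant sum are constant on an
irreducible set (`IrreducibleFor.finrank_eq`). By induction on `d`, an irreducible set on which the
low-degree dimensions are constant carries a single Hilbert series. As `S` is Noetherian, finitely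
many such sets cover `P`. -/

noncomputable section

/-! ### Regular families of subspaces, semicontinuity of dimension, irreducible parameter sets -/

section RegularFamilies

variable {k P E E' : Type*} [Field k] [AddCommGroup E] [Module k E] [AddCommGroup E'] [Module k E']

/-- A vector-valued function on `P` is regular with respect to an algebra `S` of scalar functions
when all linear functionals turn it into elements of `S`. -/
def RegularFun (S : Subalgebra k (P → k)) (v : P → E) : Prop :=
  ∀ l : E →ₗ[k] k, (fun z => l (v z)) ∈ S

/-- The values at `z` of the regular sections of the family of subspaces `W`. -/
def sectionValues (S : Subalgebra k (P → k)) (W : P → Submodule k E) (z : P) :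
    Submodule k E where
  carrier := {w | ∃ v : P → E, RegularFun S v ∧ (∀ z', v z' ∈ W z') ∧ v z = w}
  add_mem' := by
    rintro _ _ ⟨v, hv, hv', rfl⟩ ⟨w, hw, hw', rfl⟩
    refine ⟨fun z => v z + w z, fun l => ?_, fun z' => add_mem (hv' z') (hw' z'), rfl⟩
    simp only [map_add]
    exact S.add_mem (hv l) (hw l)
  zero_mem' := by
    refine ⟨fun _ => 0, fun l => ?_, fun z' => zero_mem _, rfl⟩
    simp only [map_zero]
    exact S.zero_mem
  smul_mem' := by
    rintro c _ ⟨v, hv, hv', rfl⟩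
    refine ⟨fun z => c • v z, fun l => ?_, fun z' => Submodule.smul_mem _ c (hv' z'), rfl⟩
    simp only [map_smul]
    exact S.smul_mem (hv l) c

/-- A family of subspaces is regular when each of its members is filled by the values of global
regular sections. -/
def RegularFamily (S : Subalgebra k (P → k)) (W : P → Submodule k E) : Prop :=
  ∀ z, W z ≤ sectionValues S W z

variable {S : Subalgebra k (P → k)}

theorem sectionValues_mono {W W' : P → Submodule k E} (h : ∀ z, W z ≤ W' z) (z : P) :
    sectionValues S W z ≤ sectionValues S W' z := by
  rintro _ ⟨v, hv, hv', rfl⟩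
  exact ⟨v, hv, fun z' => h z' (hv' z'), rfl⟩

theorem RegularFun.map {v : P → E} (hv : RegularFun S v) (f : E →ₗ[k] E') :
    RegularFun S fun z => f (v z) :=
  fun l => hv (l ∘ₗ f)

theorem regularFamily_const (H : Submodule k E) : RegularFamily S fun _ : P => H := by
  intro z w hw
  exact ⟨fun _ => w, fun l => S.algebraMap_mem (l w), fun _ => hw, rfl⟩

theorem RegularFamily.sup {W W' : P → Submodule k E} (h : RegularFamily S W)
    (h' : RegularFamily S W') : RegularFamily S fun z => W z ⊔ W' z := fun z =>
  sup_le ((h z).trans (sectionValues_mono (fun _ => le_sup_left) z))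
    ((h' z).trans (sectionValues_mono (fun _ => le_sup_right) z))

theorem RegularFamily.iSup {ι : Sort*} {W : ι → P → Submodule k E}
    (h : ∀ i, RegularFamily S (W i)) : RegularFamily S fun z => ⨆ i, W i z := fun z =>
  iSup_le fun i => (h i z).trans
    (sectionValues_mono (fun z => le_iSup (fun i => W i z) i) z)

theorem RegularFamily.map {W : P → Submodule k E} (h : RegularFamily S W) (f : E →ₗ[k] E') :
    RegularFamily S fun z => (W z).map f := by
  rintro z _ ⟨w, hw, rfl⟩
  obtain ⟨v, hv, hv', rfl⟩ := h z hw
  exact ⟨fun z => f (v z), hv.map f, fun z' => Submodule.mem_map_of_mem (hv' z'), rfl⟩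

theorem RegularFamily.map₂_left {E'' : Type*} [AddCommGroup E''] [Module k E'']
    {W : P → Submodule k E} (h : RegularFamily S W) (f : E →ₗ[k] E' →ₗ[k] E'')
    (H : Submodule k E') : RegularFamily S fun z => Submodule.map₂ f (W z) H := by
  intro z
  refine Submodule.map₂_le.2 fun w hw y hy => ?_
  obtain ⟨v, hv, hv', rfl⟩ := h z hw
  exact ⟨fun z => f (v z) y, hv.map (f.flip y),
    fun z' => Submodule.apply_mem_map₂ _ (hv' z') hy, rfl⟩

theorem RegularFamily.map₂_right {E'' : Type*} [AddCommGroup E''] [Module k E'']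
    {W : P → Submodule k E'} (h : RegularFamily S W) (f : E →ₗ[k] E' →ₗ[k] E'')
    (H : Submodule k E) : RegularFamily S fun z => Submodule.map₂ f H (W z) := by
  intro z
  refine Submodule.map₂_le.2 fun y hy w hw => ?_
  obtain ⟨v, hv, hv', rfl⟩ := h z hw
  exact ⟨fun z => f y (v z), hv.map (f y),
    fun z' => Submodule.apply_mem_map₂ _ hy (hv' z'), rfl⟩

theorem RegularFamily.congr {W W' : P → Submodule k E} (h : RegularFamily S W)
    (e : ∀ z, W z = W' z) : RegularFamily S W' := by
  obtain rfl : W = W' := funext e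
  exact h

/-- Subspaces of a fixed finite-dimensional space become a regular family once finitely many
functions are regular. -/
theorem exists_finite_regularFamily (H : Submodule k E) [FiniteDimensional k H]
    (W : P → Submodule k E) (hW : ∀ z, W z ≤ H) :
    ∃ G : Set (P → k), G.Finite ∧
      ∀ S : Subalgebra k (P → k), G ⊆ S → RegularFamily S W := by
  have hp : ∀ z, ∃ p : E →ₗ[k] W z, p ∘ₗ (W z).subtype = LinearMap.id := fun z =>
    LinearMap.exists_leftInverse_of_injective _ (Submodule.ker_subtype _)
  choose p hp using hp
  -- The functions required to be regular are the matrix entries, in a basis of `H`, of chosen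
  -- projections onto the subspaces.
  let b := Module.finBasis k H
  refine ⟨Set.range fun (ij : Fin (Module.finrank k H) × Fin (Module.finrank k H)) (z : P) =>
    b.repr ⟨p z (b ij.1), hW z (p z (b ij.1)).2⟩ ij.2, Set.finite_range _, ?_⟩
  intro S hS z w hw
  -- The section through `w` is `z' ↦ p z' w`, expanded in the basis so that its coefficients are
  -- constants times the chosen functions.
  refine ⟨fun z' => ∑ i, b.repr ⟨w, hW z hw⟩ i • (p z' (b i) : E), ?_, ?_, ?_⟩
  · intro l
    have key : (fun z' => l (∑ i, b.repr ⟨w, hW z hw⟩ i • (p z' (b i) : E))) =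
        ∑ i, b.repr ⟨w, hW z hw⟩ i • ∑ j, l (b j) •
          (fun z' => b.repr ⟨p z' (b i), hW z' (p z' (b i)).2⟩ j) := by
      funext z'
      simp only [map_sum, map_smul, Finset.sum_apply, Pi.smul_apply]
      refine Finset.sum_congr rfl fun i _ => ?_
      congr 1
      have := congrArg (fun x : H => l x) (b.sum_repr ⟨p z' (b i), hW z' (p z' (b i)).2⟩)
      simp only [Submodule.coe_sum, Submodule.coe_smul, map_sum, map_smul] at this
      rw [← this]
      exact Finset.sum_congr rfl fun j _ => mul_comm _ _
    rw [key]
    refine S.sum_mem fun i _ => S.smul_mem (S.sum_mem fun j _ => S.smul_mem ?_ _) _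
    exact hS ⟨(i, j), rfl⟩
  · exact fun z' => Submodule.sum_mem _ fun i _ => Submodule.smul_mem _ _ (p z' (b i)).2
  · have h1 := b.sum_repr ⟨w, hW z hw⟩
    have h2 := congrArg (fun x : H => ((p z (x : E) : W z) : E)) h1
    simp only [Submodule.coe_sum, Submodule.coe_smul, map_sum, map_smul] at h2
    refine Eq.trans h2 ?_
    exact congrArg Subtype.val (LinearMap.congr_fun (hp z) ⟨w, hw⟩)

/-- Lower semicontinuity of the dimension in a regular family. -/
theorem RegularFamily.exists_le_finrank {W : P → Submodule k E} (h : RegularFamily S W)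
    [∀ z, FiniteDimensional k (W z)] (z₀ : P) :
    ∃ f ∈ S, f z₀ ≠ 0 ∧
      ∀ z, f z ≠ 0 → Module.finrank k (W z₀) ≤ Module.finrank k (W z) := by
  set s := Module.finrank k (W z₀)
  let b := Module.finBasis k (W z₀)
  -- A basis of `W z₀` extends to regular sections. Their coordinates along `W z₀` form a matrix
  -- that is the identity at `z₀`, and the sections stay independent wherever its determinant, the
  -- required `f`, is nonzero.
  have hv : ∀ i, ∃ v : P → E, RegularFun S v ∧ (∀ z', v z' ∈ W z') ∧ v z₀ = b i :=
    fun i => h z₀ (b i).2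
  choose v hv hvW hvz using hv
  obtain ⟨p, hp⟩ := LinearMap.exists_leftInverse_of_injective _ (Submodule.ker_subtype (W z₀))
  let q : E →ₗ[k] Fin s → k := b.equivFun.toLinearMap ∘ₗ p
  let A : Matrix (Fin s) (Fin s) (P → k) := fun i j z => q (v i z) j
  have hA : ∀ z, A.det z = (Matrix.of fun i j => q (v i z) j).det := fun z =>
    RingHom.map_det (Pi.evalRingHom (fun _ : P => k) z) A
  refine ⟨A.det, ?_, ?_, ?_⟩
  · rw [Matrix.det_apply]
    refine S.sum_mem fun σ _ => ?_
    rw [Units.smul_def, zsmul_eq_mul]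
    refine S.mul_mem (S.intCast_mem _) (S.prod_mem fun i _ => ?_)
    exact hv _ (LinearMap.proj i ∘ₗ q)
  · have : (Matrix.of fun i j => q (v i z₀) j) = (1 : Matrix (Fin s) (Fin s) k) := by
      ext i j
      have h1 : p (v i z₀) = b i := by
        rw [hvz]
        exact LinearMap.congr_fun hp (b i)
      simp [q, h1, Matrix.one_apply, Finsupp.single_apply]
    rw [hA, this, Matrix.det_one]
    exact one_ne_zero
  · intro z hz
    rw [hA] at hz
    have h1 : LinearIndependent k fun i => q (v i z) :=
      Matrix.linearIndependent_rows_of_det_ne_zero hz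
    have h2 : LinearIndependent k fun i => v i z := LinearIndependent.of_comp q h1
    have h3 : LinearIndependent k fun i => (⟨v i z, hvW i z⟩ : W z) :=
      LinearIndependent.of_comp (W z).subtype h2
    simpa using h3.fintype_card_le_finrank

/-- A set of parameters is irreducible for an algebra of functions when two functions of the
algebra that do not vanish on it have a common point of nonvanishing in it. -/
def IrreducibleFor (S : Subalgebra k (P → k)) (Z : Set P) : Prop :=
  ∀ f ∈ S, ∀ g ∈ S, (∃ z ∈ Z, f z ≠ 0) → (∃ z ∈ Z, g z ≠ 0) → ∃ z ∈ Z, f z ≠ 0 ∧ g z ≠ 0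

/-- By irreducibility some `t` in `Z` satisfies both `dim U z ≤ dim U t` and `dim W z' ≤ dim W t`.
Since the sum of the dimensions at `t` equals that at `z'`, this forces `dim U z ≤ dim U z'`, and
the situation is symmetric. -/
theorem IrreducibleFor.finrank_eq {Z : Set P} (hZ : IrreducibleFor S Z)
    {U : P → Submodule k E} {W : P → Submodule k E'} (hU : RegularFamily S U)
    (hW : RegularFamily S W) [∀ z, FiniteDimensional k (U z)] [∀ z, FiniteDimensional k (W z)]
    (h : ∀ z ∈ Z, ∀ z' ∈ Z, Module.finrank k (U z) + Module.finrank k (W z) =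
      Module.finrank k (U z') + Module.finrank k (W z'))
    {z z' : P} (hz : z ∈ Z) (hz' : z' ∈ Z) :
    Module.finrank k (U z) = Module.finrank k (U z') := by
  have key : ∀ z ∈ Z, ∀ z' ∈ Z, Module.finrank k (U z) ≤ Module.finrank k (U z') := by
    intro z hz z' hz'
    obtain ⟨f, hf, hfz, hf'⟩ := hU.exists_le_finrank z
    obtain ⟨g, hg, hgz, hg'⟩ := hW.exists_le_finrank z'
    obtain ⟨t, ht, hft, hgt⟩ := hZ f hf g hg ⟨z, hz, hfz⟩ ⟨z', hz', hgz⟩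
    have h1 := hf' t hft
    have h2 := hg' t hgt
    have h3 := h t ht z' hz'
    omega
  exact le_antisymm (key z hz z' hz') (key z' hz' z hz)

/-- Sending a point to the kernel of evaluation maps `Q` to `Spec S`. By Hilbert's basis theorem `S`
is Noetherian, hence so is the induced topology on `Q`, and its finitely many irreducible components
give the cover. -/
theorem exists_finite_cover_irreducibleFor (hS : S.FG) (Q : Set P) :
    ∃ C : Set (Set P), C.Finite ∧ (∀ Z ∈ C, IrreducibleFor S Z ∧ Z ⊆ Q) ∧
      ∀ z ∈ Q, ∃ Z ∈ C, z ∈ Z := by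
  have : IsNoetherianRing S := isNoetherianRing_of_fg hS
  let ev : P → S →+* k := fun z => (Pi.evalRingHom (fun _ : P => k) z).comp S.val.toRingHom
  let pt : Q → PrimeSpectrum S := fun z => ⟨RingHom.ker (ev z), RingHom.ker_isPrime _⟩
  let : TopologicalSpace Q := TopologicalSpace.induced pt inferInstance
  have hpt : Topology.IsInducing pt := ⟨rfl⟩
  have : TopologicalSpace.NoetherianSpace Q := hpt.noetherianSpace
  have hopen : ∀ f : S, IsOpen {z : Q | (f : P → k) z ≠ 0} := fun f =>
    (PrimeSpectrum.basicOpen f).isOpen.preimage hpt.continuous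
  refine ⟨(fun Z => Subtype.val '' Z) '' irreducibleComponents Q,
    TopologicalSpace.NoetherianSpace.finite_irreducibleComponents.image _, ?_, ?_⟩
  · rintro _ ⟨Z, hZ, rfl⟩
    refine ⟨?_, by rintro _ ⟨z, _, rfl⟩; exact z.2⟩
    rintro f hf g hg ⟨_, ⟨z, hz, rfl⟩, hfz⟩ ⟨_, ⟨z', hz', rfl⟩, hgz⟩
    obtain ⟨t, ht, h1, h2⟩ := (show IsIrreducible Z from hZ.1).isPreirreducible
      _ _ (hopen ⟨f, hf⟩) (hopen ⟨g, hg⟩) ⟨z, hz, hfz⟩ ⟨z', hz', hgz⟩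
    exact ⟨t, ⟨t, ht, rfl⟩, h1, h2⟩
  · intro z hz
    exact ⟨_, ⟨_, irreducibleComponent_mem_irreducibleComponents ⟨z, hz⟩, rfl⟩,
      ⟨z, hz⟩, mem_irreducibleComponent, rfl⟩

/-- A function on `P` has finitely many values if it is constant on the irreducible sets on which
a given function with finitely many values is constant. -/
theorem finite_range_of_irreducibleFor {α β : Type*} (hS : S.FG) (c : P → α)
    (hc : (Set.range c).Finite) (h : P → β)
    (hh : ∀ Z : Set P, IrreducibleFor S Z → (∀ z ∈ Z, ∀ z' ∈ Z, c z = c z') →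
      ∀ z ∈ Z, ∀ z' ∈ Z, h z = h z') : (Set.range h).Finite := by
  -- Each of the finitely many fibres of `c` is covered by finitely many irreducible sets, and `h`
  -- is constant on each of them.
  have key : ∀ x, (h '' (c ⁻¹' {x})).Finite := by
    intro x
    obtain ⟨C, hC, hC', hcov⟩ := exists_finite_cover_irreducibleFor hS (c ⁻¹' {x})
    refine (hC.biUnion (t := fun Z => h '' Z) fun Z hZ => ?_).subset ?_
    · refine Set.Subsingleton.finite ?_
      rintro _ ⟨z, hz, rfl⟩ _ ⟨z', hz', rfl⟩
      refine hh Z (hC' Z hZ).1 (fun y hy y' hy' => ?_) z hz z' hz'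
      exact ((hC' Z hZ).2 hy).trans ((hC' Z hZ).2 hy').symm
    · rintro _ ⟨z, hz, rfl⟩
      obtain ⟨Z, hZ, hzZ⟩ := hcov z hz
      exact Set.mem_biUnion hZ ⟨z, hzZ, rfl⟩
  refine (hc.biUnion fun x _ => key x).subset ?_
  rintro _ ⟨z, rfl⟩
  exact Set.mem_biUnion ⟨z, rfl⟩ ⟨z, rfl, rfl⟩

end RegularFamilies

/-! ### Graded linear algebra: sections, tensor products, dimensions -/

section GradedLinear

variable {k : Type*} [Field k] {ι X X' Y Y' : Type*} [AddCommGroup X] [Module k X]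
  [AddCommGroup X'] [Module k X'] [AddCommGroup Y] [Module k Y] [AddCommGroup Y'] [Module k Y']

/-- The maps `p i` read off the components of a formal sum from its value, which gives injectivity.
Spanning is the hypothesis `h₃`. -/
theorem isInternal_of_projections [DecidableEq ι] (D : ι → Submodule k X) (p : ι → X →ₗ[k] X)
    (h₁ : ∀ i, ∀ x ∈ D i, p i x = x) (h₂ : ∀ i j, i ≠ j → ∀ x ∈ D j, p i x = 0)
    (h₃ : ∀ x, x ∈ ⨆ i, D i) : DirectSum.IsInternal D := by
  have key : ∀ (a : DirectSum ι fun i => D i) (i : ι),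
      p i (DirectSum.coeLinearMap D a) = a i := by
    intro a i
    induction a using DirectSum.induction_on with
    | zero => simp
    | of j x =>
      rw [DirectSum.coeLinearMap_of]
      by_cases h : i = j
      · subst h
        rw [h₁ i x x.2, DirectSum.of_eq_same]
      · rw [h₂ i j h x x.2, DirectSum.of_eq_of_ne _ _ _ h]
        rfl
    | add a b ha hb => simp [ha, hb]
  constructor
  · refine (injective_iff_map_eq_zero (DirectSum.coeAddMonoidHom D)).2 fun a ha => ?_
    ext i
    rw [← key a i]
    have : DirectSum.coeLinearMap D a = 0 := ha
    rw [this, map_zero]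
    rfl
  · intro x
    have := h₃ x
    rw [Submodule.iSup_eq_range_dfinsupp_lsum] at this
    exact this

theorem exists_linearMap_of_components [DecidableEq ι] (D : ι → Submodule k X)
    [DirectSum.Decomposition D] (f : ∀ i, D i →ₗ[k] X') :
    ∃ g : X →ₗ[k] X', ∀ i (x : D i), g x = f i x :=
  ⟨DirectSum.toModule k ι X' f ∘ₗ (DirectSum.decomposeLinearEquiv D).toLinearMap,
    fun i x => by simp⟩

/-- A linear map of degree `0` between graded spaces that has a linear right inverse of
degree `0`. -/
def HasGradedSection (V : ι → Submodule k X) (V' : ι → Submodule k X') (f : X →ₗ[k] X') : Prop :=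
  (∀ i, ∀ x ∈ V i, f x ∈ V' i) ∧
    ∃ s : X' →ₗ[k] X, f ∘ₗ s = LinearMap.id ∧ ∀ i, ∀ y ∈ V' i, s y ∈ V i

theorem hasGradedSection_of_surjective [DecidableEq ι] (V : ι → Submodule k X)
    (V' : ι → Submodule k X') [DirectSum.Decomposition V'] (f : X →ₗ[k] X')
    (hf : ∀ i, ∀ x ∈ V i, f x ∈ V' i) (hs : ∀ i, ∀ y ∈ V' i, ∃ x ∈ V i, f x = y) :
    HasGradedSection V V' f := by
  refine ⟨hf, ?_⟩
  have h : ∀ i, ∃ g : V' i →ₗ[k] V i, f.restrict (hf i) ∘ₗ g = LinearMap.id := by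
    intro i
    refine LinearMap.exists_rightInverse_of_surjective _ (LinearMap.range_eq_top.2 ?_)
    rintro ⟨y, hy⟩
    obtain ⟨x, hx, rfl⟩ := hs i y hy
    exact ⟨⟨x, hx⟩, rfl⟩
  choose g hg using h
  obtain ⟨s, hs⟩ := exists_linearMap_of_components V' fun i => (V i).subtype ∘ₗ g i
  refine ⟨s, ?_, fun i y hy => ?_⟩
  · ext y
    induction y using DirectSum.Decomposition.inductionOn V' with
    | zero => simp
    | @homogeneous i y =>
      have := congrArg Subtype.val (LinearMap.congr_fun (hg i) y)
      simpa [hs i y] using this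
    | add a b ha hb => simp only [map_add, ha, hb]
  · rw [hs i ⟨y, hy⟩]
    exact (g i ⟨y, hy⟩).2

theorem HasGradedSection.map_eq {V : ι → Submodule k X} {V' : ι → Submodule k X'}
    {f : X →ₗ[k] X'} (h : HasGradedSection V V' f) (i : ι) : (V i).map f = V' i := by
  obtain ⟨hf, s, hs, hs'⟩ := h
  apply le_antisymm
  · rintro _ ⟨x, hx, rfl⟩
    exact hf i x hx
  · intro y hy
    exact ⟨s y, hs' i y hy, LinearMap.congr_fun hs y⟩

theorem finrank_map_add_finrank_ker_inf (f : X →ₗ[k] X') (U : Submodule k X)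
    [FiniteDimensional k U] :
    Module.finrank k (U.map f) + Module.finrank k ↥(LinearMap.ker f ⊓ U) =
      Module.finrank k U := by
  have h := (f.domRestrict U).finrank_range_add_finrank_ker
  rw [LinearMap.range_domRestrict] at h
  rw [← h, LinearMap.ker_domRestrict]
  congr 1
  have e : LinearMap.ker f ⊓ U = ((LinearMap.ker f).comap U.subtype).map U.subtype := by
    rw [Submodule.map_comap_subtype, inf_comm]
  rw [e]
  exact Submodule.finrank_map_subtype_eq _ _

/-- The homogeneous components of a tensor product of graded spaces. -/
def tensorDeg (V : ℤ → Submodule k X) (W : ℕ → Submodule k Y) (d : ℤ) : Submodule k (X ⊗[k] Y) :=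
  ⨆ l : ℕ, Submodule.map₂ (TensorProduct.mk k X Y) (V (d - l)) (W l)

theorem tmul_mem_tensorDeg {V : ℤ → Submodule k X} {W : ℕ → Submodule k Y} {d : ℤ} {l : ℕ}
    {x : X} {y : Y} (hx : x ∈ V (d - l)) (hy : y ∈ W l) : x ⊗ₜ[k] y ∈ tensorDeg V W d :=
  Submodule.mem_iSup_of_mem l (Submodule.apply_mem_map₂ _ hx hy)

theorem tensorDeg_le {V : ℤ → Submodule k X} {W : ℕ → Submodule k Y} {d : ℤ}
    {U : Submodule k (X ⊗[k] Y)}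
    (h : ∀ l : ℕ, ∀ x ∈ V (d - l), ∀ y ∈ W l, x ⊗ₜ[k] y ∈ U) : tensorDeg V W d ≤ U :=
  iSup_le fun l => Submodule.map₂_le.2 fun x hx y hy => h l x hx y hy

theorem tensorDeg_map_le {V : ℤ → Submodule k X} {W : ℕ → Submodule k Y}
    {V' : ℤ → Submodule k X'} {W' : ℕ → Submodule k Y'} {d : ℤ} {f : X →ₗ[k] X'}
    {g : Y →ₗ[k] Y'} (hf : ∀ l : ℕ, ∀ x ∈ V (d - l), ∀ y ∈ W l, f x ⊗ₜ[k] g y ∈ tensorDeg V' W' d)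
    {t : X ⊗[k] Y} (ht : t ∈ tensorDeg V W d) : TensorProduct.map f g t ∈ tensorDeg V' W' d := by
  have : tensorDeg V W d ≤ (tensorDeg V' W' d).comap (TensorProduct.map f g) :=
    tensorDeg_le fun l x hx y hy => hf l x hx y hy
  exact this ht

theorem HasGradedSection.tensor {V : ℤ → Submodule k X} {W : ℕ → Submodule k Y}
    {V' : ℤ → Submodule k X'} {W' : ℕ → Submodule k Y'} {f : X →ₗ[k] X'} {g : Y →ₗ[k] Y'}
    (hf : HasGradedSection V V' f) (hg : HasGradedSection W W' g) :
    HasGradedSection (tensorDeg V W) (tensorDeg V' W') (TensorProduct.map f g) := by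
  obtain ⟨hf, s, hs, hs'⟩ := hf
  obtain ⟨hg, t, ht, ht'⟩ := hg
  refine ⟨fun d x hx => tensorDeg_map_le
    (fun l x hx y hy => tmul_mem_tensorDeg (hf _ x hx) (hg l y hy)) hx,
    TensorProduct.map s t, ?_, fun d x hx => tensorDeg_map_le
    (fun l x hx y hy => tmul_mem_tensorDeg (hs' _ x hx) (ht' l y hy)) hx⟩
  rw [← TensorProduct.map_comp, hs, ht, TensorProduct.map_id]

/-- The kernel of a tensor product of two graded maps with graded sections, in a given degree. -/
theorem ker_inf_tensorDeg {V : ℤ → Submodule k X} {W : ℕ → Submodule k Y}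
    {V' : ℤ → Submodule k X'} {W' : ℕ → Submodule k Y'} {f : X →ₗ[k] X'} {g : Y →ₗ[k] Y'}
    (hf : HasGradedSection V V' f) (hg : HasGradedSection W W' g) (d : ℤ) :
    LinearMap.ker (TensorProduct.map f g) ⊓ tensorDeg V W d =
      ⨆ l : ℕ, (Submodule.map₂ (TensorProduct.mk k X Y) (LinearMap.ker f ⊓ V (d - l)) (W l) ⊔
        Submodule.map₂ (TensorProduct.mk k X Y) (V (d - l)) (LinearMap.ker g ⊓ W l)) := by
  apply le_antisymm
  · obtain ⟨hf, s, hs, hs'⟩ := hf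
    obtain ⟨hg, t, ht, ht'⟩ := hg
    set R := ⨆ l : ℕ, (Submodule.map₂ (TensorProduct.mk k X Y) (LinearMap.ker f ⊓ V (d - l)) (W l) ⊔
        Submodule.map₂ (TensorProduct.mk k X Y) (V (d - l)) (LinearMap.ker g ⊓ W l))
    -- An element of the kernel is fixed by `id - (s ⊗ t) ∘ (f ⊗ g)`. On a pure tensor this operator
    -- telescopes into a term with first factor in `ker f` and a term with second factor in `ker g`.
    have key : tensorDeg V W d ≤ R.comap
        ((LinearMap.id : X ⊗[k] Y →ₗ[k] X ⊗[k] Y) - TensorProduct.map s t ∘ₗ TensorProduct.map f g) := by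
      refine tensorDeg_le fun l x hx y hy => ?_
      have e : ((LinearMap.id : X ⊗[k] Y →ₗ[k] X ⊗[k] Y) -
          TensorProduct.map s t ∘ₗ TensorProduct.map f g) (x ⊗ₜ[k] y) =
          (x - s (f x)) ⊗ₜ[k] y + s (f x) ⊗ₜ[k] (y - t (g y)) := by
        simp [TensorProduct.sub_tmul, TensorProduct.tmul_sub]
      have hsf := hs' _ _ (hf _ x hx)
      have htg := ht' _ _ (hg _ y hy)
      have hs1 : f (s (f x)) = f x := LinearMap.congr_fun hs (f x)
      have ht1 : g (t (g y)) = g y := LinearMap.congr_fun ht (g y)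
      rw [Submodule.mem_comap, e]
      refine Submodule.mem_iSup_of_mem l (Submodule.add_mem_sup ?_ ?_)
      · refine Submodule.apply_mem_map₂ _ ⟨?_, sub_mem hx hsf⟩ hy
        rw [SetLike.mem_coe, LinearMap.mem_ker, map_sub, hs1, sub_self]
      · refine Submodule.apply_mem_map₂ _ hsf ⟨?_, sub_mem hy htg⟩
        rw [SetLike.mem_coe, LinearMap.mem_ker, map_sub, ht1, sub_self]
    rintro x ⟨hx, hx'⟩
    have := key hx'
    rw [SetLike.mem_coe, LinearMap.mem_ker] at hx
    simpa [hx] using this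
  · refine iSup_le fun l => sup_le (Submodule.map₂_le.2 ?_) (Submodule.map₂_le.2 ?_)
    · rintro x ⟨hx, hx'⟩ y hy
      rw [SetLike.mem_coe, LinearMap.mem_ker] at hx
      exact ⟨by simp [hx], tmul_mem_tensorDeg hx' hy⟩
    · rintro x hx y ⟨hy, hy'⟩
      rw [SetLike.mem_coe, LinearMap.mem_ker] at hy
      exact ⟨by simp [hy], tmul_mem_tensorDeg hx hy'⟩

theorem tensorDeg_eq_bot {V : ℤ → Submodule k X} {p : ℤ} (hV : ∀ i < p, V i = ⊥)
    (W : ℕ → Submodule k Y) {d : ℤ} (hd : d < p) : tensorDeg V W d = ⊥ := by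
  refine iSup_eq_bot.2 fun l => ?_
  rw [hV _ (by omega), Submodule.map₂_bot_left]

theorem finiteDimensional_tensorDeg {V : ℤ → Submodule k X} {W : ℕ → Submodule k Y} {p : ℤ}
    (hV : ∀ i < p, V i = ⊥) (hVf : ∀ i, FiniteDimensional k (V i))
    (hWf : ∀ i, FiniteDimensional k (W i)) (d : ℤ) :
    FiniteDimensional k (tensorDeg V W d) := by
  -- Since `V` vanishes below `p`, only the summands with `l ≤ d - p` survive.
  have e : tensorDeg V W d = ⨆ l : Fin (d - p + 1).toNat,
      Submodule.map₂ (TensorProduct.mk k X Y) (V (d - (l : ℕ))) (W l) := by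
    apply le_antisymm
    · refine iSup_le fun l => ?_
      by_cases hl : l < (d - p + 1).toNat
      · exact le_iSup (fun l : Fin (d - p + 1).toNat =>
          Submodule.map₂ (TensorProduct.mk k X Y) (V (d - (l : ℕ))) (W l)) ⟨l, hl⟩
      · rw [hV _ (by omega), Submodule.map₂_bot_left]
        exact bot_le
    · exact iSup_le fun l => le_iSup (fun l : ℕ =>
          Submodule.map₂ (TensorProduct.mk k X Y) (V (d - (l : ℕ))) (W l)) (l : ℕ)
  rw [e]
  have : ∀ l : Fin (d - p + 1).toNat, FiniteDimensional k
      (Submodule.map₂ (TensorProduct.mk k X Y) (V (d - (l : ℕ))) (W l)) := fun l =>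
    Module.Finite.iff_fg.2 (Submodule.FG.map₂ _ (Module.Finite.iff_fg.1 (hVf _))
      (Module.Finite.iff_fg.1 (hWf _)))
  infer_instance

theorem exists_leftInverse_of_finrank_le {U : Submodule k X} {U' : Submodule k X'}
    [FiniteDimensional k U] [FiniteDimensional k U']
    (h : Module.finrank k U ≤ Module.finrank k U') :
    ∃ (f : U →ₗ[k] U') (g : U' →ₗ[k] U), g ∘ₗ f = LinearMap.id := by
  obtain ⟨f, hf⟩ := finrank_le_iff_exists_linearMap.1 h
  obtain ⟨g, hg⟩ := LinearMap.exists_leftInverse_of_injective f (LinearMap.ker_eq_bot.2 hf)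
  exact ⟨f, g, hg⟩

/-- In degrees where the dimensions do not allow an embedding both maps are zero. One global pair of
maps then serves a comparison that is available in some degrees only. -/
theorem exists_graded_inverse [DecidableEq ι] (V : ι → Submodule k X) (V' : ι → Submodule k X')
    [DirectSum.Decomposition V] [DirectSum.Decomposition V'] [∀ i, FiniteDimensional k (V i)]
    [∀ i, FiniteDimensional k (V' i)] :
    ∃ (f : X →ₗ[k] X') (g : X' →ₗ[k] X), (∀ i, ∀ x ∈ V i, f x ∈ V' i) ∧
      ∀ i, Module.finrank k (V i) ≤ Module.finrank k (V' i) → ∀ x ∈ V i, g (f x) = x := by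
  have h : ∀ i, ∃ (f : V i →ₗ[k] V' i) (g : V' i →ₗ[k] V i),
      Module.finrank k (V i) ≤ Module.finrank k (V' i) → g ∘ₗ f = LinearMap.id := by
    intro i
    by_cases hi : Module.finrank k (V i) ≤ Module.finrank k (V' i)
    · obtain ⟨f, g, h⟩ := exists_leftInverse_of_finrank_le hi
      exact ⟨f, g, fun _ => h⟩
    · exact ⟨0, 0, fun h => absurd h hi⟩
  choose f g hfg using h
  obtain ⟨F, hF⟩ := exists_linearMap_of_components V fun i => (V' i).subtype ∘ₗ f i
  obtain ⟨G, hG⟩ := exists_linearMap_of_components V' fun i => (V i).subtype ∘ₗ g i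
  refine ⟨F, G, fun i x hx => ?_, fun i hi x hx => ?_⟩
  · rw [hF i ⟨x, hx⟩]
    exact (f i ⟨x, hx⟩).2
  · rw [hF i ⟨x, hx⟩]
    change G (f i ⟨x, hx⟩ : X') = x
    rw [hG i]
    exact congrArg Subtype.val (LinearMap.congr_fun (hfg i hi) ⟨x, hx⟩)

/-- A dimension formula for the tensor product is avoided: the tensor product of two componentwise
embeddings is injective in degree `d`, being undone on every relevant summand by the tensor product
of the left inverses. -/
theorem finrank_tensorDeg_le {V : ℤ → Submodule k X} {W : ℕ → Submodule k Y}
    {V' : ℤ → Submodule k X'} {W' : ℕ → Submodule k Y'} [DirectSum.Decomposition V]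
    [DirectSum.Decomposition V'] [DirectSum.Decomposition W] [DirectSum.Decomposition W']
    [∀ i, FiniteDimensional k (V i)] [∀ i, FiniteDimensional k (V' i)]
    [∀ i, FiniteDimensional k (W i)] [∀ i, FiniteDimensional k (W' i)] {d : ℤ}
    [FiniteDimensional k (tensorDeg V' W' d)]
    (h : ∀ l : ℕ, V (d - l) = ⊥ ∨ W l = ⊥ ∨
      (Module.finrank k (V (d - l)) ≤ Module.finrank k (V' (d - l)) ∧
        Module.finrank k (W l) ≤ Module.finrank k (W' l))) :
    Module.finrank k (tensorDeg V W d) ≤ Module.finrank k (tensorDeg V' W' d) := by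
  obtain ⟨f, g, hf, hfg⟩ := exists_graded_inverse V V'
  obtain ⟨f', g', hf', hfg'⟩ := exists_graded_inverse W W'
  have h₁ : ∀ t ∈ tensorDeg V W d, TensorProduct.map f f' t ∈ tensorDeg V' W' d := fun t ht =>
    tensorDeg_map_le (fun l x hx y hy => tmul_mem_tensorDeg (hf _ x hx) (hf' l y hy)) ht
  have h₂ : tensorDeg V W d ≤ LinearMap.eqLocus
      (TensorProduct.map g g' ∘ₗ TensorProduct.map f f') LinearMap.id := by
    refine tensorDeg_le fun l x hx y hy => ?_
    rw [LinearMap.mem_eqLocus]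
    rcases h l with h | h | ⟨h, h'⟩
    · rw [h, Submodule.mem_bot] at hx
      simp [hx]
    · rw [h, Submodule.mem_bot] at hy
      simp [hy]
    · simp [hfg _ h x hx, hfg' _ h' y hy]
  refine LinearMap.finrank_le_finrank_of_injective
    (f := (TensorProduct.map f f').restrict h₁) fun x y hxy => Subtype.ext ?_
  have hx := h₂ x.2
  have hy := h₂ y.2
  rw [LinearMap.mem_eqLocus] at hx hy
  have e : TensorProduct.map f f' (x : X ⊗[k] Y) = TensorProduct.map f f' (y : X ⊗[k] Y) :=
    congrArg Subtype.val hxy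
  simp only [LinearMap.comp_apply, LinearMap.id_apply] at hx hy
  rw [← hx, ← hy, e]

end GradedLinear

/-! ### The bar complex: degrees, differentials, exactness -/

namespace ConnGradedAlgebra

variable {k : Type u} [Field k]

/-- The homogeneous components of the augmentation ideal. -/
def plusDeg (A : ConnGradedAlgebra k) (l : ℕ) : Submodule k A.plus :=
  (A.deg l).comap A.plus.subtype

end ConnGradedAlgebra

namespace GradedRightModule

variable {k : Type u} [Field k] {T A : ConnGradedAlgebra k}

section BarStep

variable {X X' : Type u} [AddCommGroup X] [Module k X] [AddCommGroup X'] [Module k X']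

theorem barStep_tmul (s : k) (d : X ⊗[k] A.plus →ₗ[k] X) (x : X) (a b : A.plus) :
    barStep A s d ((x ⊗ₜ a) ⊗ₜ b) = d (x ⊗ₜ a) ⊗ₜ b + s • (x ⊗ₜ A.plusMul a b) := by
  simp [barStep]

theorem map_barStep (s : k) (f : X →ₗ[k] X') (β : T.plus →ₗ[k] A.plus)
    (hβ : ∀ a b, β (T.plusMul a b) = A.plusMul (β a) (β b)) (d : X ⊗[k] T.plus →ₗ[k] X)
    (d' : X' ⊗[k] A.plus →ₗ[k] X') (hd : f ∘ₗ d = d' ∘ₗ TensorProduct.map f β) :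
    TensorProduct.map f β ∘ₗ barStep T s d =
      barStep A s d' ∘ₗ TensorProduct.map (TensorProduct.map f β) β := by
  apply TensorProduct.ext_threefold
  intro x a b
  have h : f (d (x ⊗ₜ a)) = d' (f x ⊗ₜ β a) := LinearMap.congr_fun hd (x ⊗ₜ a)
  simp only [LinearMap.comp_apply, barStep_tmul, TensorProduct.map_tmul, map_add, map_smul, h, hβ]

theorem barStep_mem (s : k) (V : ℤ → Submodule k X) (d : X ⊗[k] A.plus →ₗ[k] X)
    (hd : ∀ j, ∀ t ∈ tensorDeg V A.plusDeg j, d t ∈ V j) (j : ℤ) :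
    ∀ t ∈ tensorDeg (tensorDeg V A.plusDeg) A.plusDeg j,
      barStep A s d t ∈ tensorDeg V A.plusDeg j := by
  suffices h : tensorDeg (tensorDeg V A.plusDeg) A.plusDeg j ≤
      (tensorDeg V A.plusDeg j).comap (barStep A s d) from fun _ ht => h ht
  refine tensorDeg_le fun l t ht b hb => ?_
  have h : tensorDeg V A.plusDeg (j - l) ≤ ((tensorDeg V A.plusDeg j).comap
      (barStep A s d)).comap ((TensorProduct.mk k (X ⊗[k] A.plus) A.plus).flip b) := ?_
  · exact h ht
  refine tensorDeg_le fun l' x hx a ha => ?_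
  change barStep A s d ((x ⊗ₜ a) ⊗ₜ b) ∈ tensorDeg V A.plusDeg j
  rw [barStep_tmul]
  refine add_mem (tmul_mem_tensorDeg (hd _ _ (tmul_mem_tensorDeg hx ha)) hb)
    (Submodule.smul_mem _ _ (tmul_mem_tensorDeg (l := l' + l) ?_ ?_))
  · convert hx using 1
    push_cast
    ring_nf
  · exact SetLike.mul_mem_graded (A := A.deg) (show a.1 ∈ A.deg l' from ha)
      (show b.1 ∈ A.deg l from hb)

/-- On `x ⊗ a ⊗ b ⊗ c` the two terms `d (x ⊗ a) ⊗ b c` have opposite signs, the terms `x ⊗ a b c`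
cancel by associativity, and the rest is `hd` tensored with `c`. -/
theorem barStep_comp_barStep (s : k) (hs : s * s = 1) (d : X ⊗[k] A.plus →ₗ[k] X)
    (hd : d ∘ₗ barStep A s d = 0) :
    barStep A s d ∘ₗ barStep A (-s) (barStep A s d) = 0 := by
  apply TensorProduct.ext_threefold
  intro t b c
  induction t using TensorProduct.induction_on with
  | zero => simp
  | add t t' ht ht' => simp only [TensorProduct.add_tmul, map_add, ht, ht', LinearMap.zero_apply]
  | tmul x a =>
    have h : d (d (x ⊗ₜ a) ⊗ₜ b) + s • d (x ⊗ₜ A.plusMul a b) = 0 := by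
      have := LinearMap.congr_fun hd ((x ⊗ₜ a) ⊗ₜ b)
      rwa [LinearMap.comp_apply, barStep_tmul, map_add, map_smul] at this
    have hassoc : A.plusMul (A.plusMul a b) c = A.plusMul a (A.plusMul b c) :=
      Subtype.ext (mul_assoc a.1 b.1 c.1)
    have h' := congrArg (fun y : X => y ⊗ₜ[k] c) h
    simp only [TensorProduct.add_tmul, TensorProduct.zero_tmul] at h'
    simp only [LinearMap.comp_apply, barStep_tmul, map_add, map_smul, TensorProduct.add_tmul,
      smul_add, ← TensorProduct.smul_tmul', hassoc, smul_smul, neg_mul, hs, neg_smul, one_smul,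
      LinearMap.zero_apply]
    simp only [← TensorProduct.smul_tmul'] at h'
    rw [← h']
    abel

end BarStep

section Bar

variable (M : GradedRightModule A)

theorem act_mem {i : ℤ} {l : ℕ} {x : M.carrier} {a : A.plus} (hx : x ∈ M.deg i)
    (ha : a ∈ A.plusDeg l) : M.act x a ∈ M.deg (i + l) :=
  M.smul_mem i l x a hx ha

theorem barD_mem : ∀ (n : ℕ) (j : ℤ), ∀ t ∈ M.barDeg (n + 1) j, M.barD n t ∈ M.barDeg n j
  | 0, j => by
    suffices h : tensorDeg M.deg A.plusDeg j ≤ (M.deg j).comap (TensorProduct.lift M.act) from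
      fun t ht => h ht
    refine tensorDeg_le fun l x hx a ha => ?_
    have := M.act_mem hx ha
    rwa [sub_add_cancel] at this
  | n + 1, j => barStep_mem (X := M.bar n) ((-1) ^ (n + 1)) (M.barDeg n) (M.barD n)
      (fun j t ht => barD_mem n j t ht) j

theorem barD_barD : ∀ (n : ℕ), M.barD n ∘ₗ M.barD (n + 1) = 0
  | 0 => by
    have : TensorProduct.lift M.act ∘ₗ barStep A ((-1) ^ (0 + 1)) (TensorProduct.lift M.act)
        = 0 := by
      apply TensorProduct.ext_threefold
      intro x a b
      rw [LinearMap.comp_apply, barStep_tmul, map_add, map_smul, TensorProduct.lift.tmul,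
        TensorProduct.lift.tmul, TensorProduct.lift.tmul, zero_add, pow_one, neg_smul, one_smul]
      change MulOpposite.op b.1 • MulOpposite.op a.1 • x + -(MulOpposite.op (a.1 * b.1) • x) = 0
      rw [MulOpposite.op_mul, mul_smul, add_neg_cancel]
    exact this
  | n + 1 => by
    have h := barStep_comp_barStep (X := M.bar n) (A := A) ((-1) ^ (n + 1))
      (by rw [← mul_pow, neg_one_mul, neg_neg, one_pow]) (M.barD n) (barD_barD n)
    have e : (-1 : k) ^ (n + 1 + 1) = -(-1) ^ (n + 1) := by rw [pow_succ, mul_neg_one]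
    rw [← e] at h
    exact h

theorem finrank_map_barD_add (n : ℕ) (d : ℤ) [FiniteDimensional k (M.barDeg (n + 1) d)] :
    Module.finrank k ((M.barDeg (n + 1) d).map (M.barD n)) +
      Module.finrank k ↥(LinearMap.ker (M.barD n) ⊓ M.barDeg (n + 1) d) =
        Module.finrank k (M.barDeg (n + 1) d) :=
  finrank_map_add_finrank_ker_inf (M.barD n) (M.barDeg (n + 1) d)

theorem barDeg_eq_bot {p : ℤ} (hM : ∀ i < p, M.deg i = ⊥) :
    ∀ (n : ℕ), ∀ i < p, M.barDeg n i = ⊥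
  | 0 => hM
  | n + 1 => fun _ hi => tensorDeg_eq_bot (barDeg_eq_bot hM n) A.plusDeg hi

theorem finiteDimensional_barDeg {p : ℤ} (hM : ∀ i < p, M.deg i = ⊥)
    (hMf : ∀ i, FiniteDimensional k (M.deg i)) (hA : ∀ l, FiniteDimensional k (A.plusDeg l)) :
    ∀ (n : ℕ) (i : ℤ), FiniteDimensional k (M.barDeg n i)
  | 0 => hMf
  | n + 1 => fun i => finiteDimensional_tensorDeg (M.barDeg_eq_bot hM n)
      (fun i => finiteDimensional_barDeg hM hMf hA n i) hA i

/-- Exactness of the bar complex at its `i`-th space in degree `j`. -/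
def ExactAt (i : ℕ) (j : ℤ) : Prop :=
  ∀ x ∈ M.barCycles i, x ∈ M.barDeg i j → ∃ y ∈ M.barDeg (i + 1) j, M.barD i y = x

variable {M}

theorem ExactAt.map_barD_eq {n : ℕ} {d : ℤ} (h : M.ExactAt (n + 1) d) :
    (M.barDeg (n + 1 + 1) d).map (M.barD (n + 1)) =
      LinearMap.ker (M.barD n) ⊓ M.barDeg (n + 1) d := by
  apply le_antisymm
  · rintro _ ⟨y, hy, rfl⟩
    exact ⟨LinearMap.congr_fun (M.barD_barD n) y, M.barD_mem (n + 1) d y hy⟩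
  · rintro x ⟨hx, hxd⟩
    obtain ⟨y, hy, rfl⟩ := h x hx hxd
    exact ⟨y, hy, rfl⟩

theorem ExactAt.map_barD_zero_eq {d : ℤ} (h : M.ExactAt 0 d) :
    (M.barDeg (0 + 1) d).map (M.barD 0) = M.barDeg 0 d := by
  apply le_antisymm
  · rintro _ ⟨x, hx, rfl⟩
    exact M.barD_mem 0 d x hx
  · intro x hx
    obtain ⟨y, hy, rfl⟩ := h x trivial hx
    exact ⟨y, hy, rfl⟩

end Bar

/-! ### Covers of modules, and dimension counts in their bar complexes -/

/-- The map of bar constructions given by linear maps of the modules and of the augmentation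
ideals. -/
def barMap (F : GradedRightModule T) (M : GradedRightModule A) (α : F.carrier →ₗ[k] M.carrier)
    (β : T.plus →ₗ[k] A.plus) : (n : ℕ) → F.bar n →ₗ[k] M.bar n
  | 0 => α
  | n + 1 => (TensorProduct.map (barMap F M α β n) β :
      F.bar n ⊗[k] T.plus →ₗ[k] M.bar n ⊗[k] A.plus)

/-- A surjective graded map from a `T`-module to an `A`-module along a surjective graded map from
`T₊` to `A₊`. -/
structure BarCover (F : GradedRightModule T) (M : GradedRightModule A)
    (α : F.carrier →ₗ[k] M.carrier) (β : T.plus →ₗ[k] A.plus) : Prop where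
  section_module : HasGradedSection F.deg M.deg α
  section_plus : HasGradedSection T.plusDeg A.plusDeg β
  map_act : ∀ x a, α (F.act x a) = M.act (α x) (β a)
  map_mul : ∀ a b, β (T.plusMul a b) = A.plusMul (β a) (β b)

namespace BarCover

variable {F : GradedRightModule T} {M : GradedRightModule A} {α : F.carrier →ₗ[k] M.carrier}
  {β : T.plus →ₗ[k] A.plus} (h : BarCover F M α β)

include h

theorem hasGradedSection : ∀ n, HasGradedSection (F.barDeg n) (M.barDeg n) (barMap F M α β n)
  | 0 => h.section_module
  | n + 1 => (hasGradedSection n).tensor h.section_plus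

theorem barMap_barD : ∀ n, barMap F M α β n ∘ₗ F.barD n = M.barD n ∘ₗ barMap F M α β (n + 1)
  | 0 => TensorProduct.ext' fun x a => h.map_act x a
  | n + 1 => map_barStep (X := F.bar n) (X' := M.bar n) _ (barMap F M α β n) β h.map_mul
      (F.barD n) (M.barD n) (barMap_barD n)

theorem barMap_barD_apply (n : ℕ) (t : F.bar (n + 1)) :
    barMap F M α β n (F.barD n t) = M.barD n (barMap F M α β (n + 1) t) :=
  LinearMap.congr_fun (h.barMap_barD n) t

theorem ker_inf_barDeg_succ (n : ℕ) (d : ℤ) :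
    LinearMap.ker (barMap F M α β (n + 1)) ⊓ F.barDeg (n + 1) d =
      (⨆ l : ℕ, (Submodule.map₂ (TensorProduct.mk k (F.bar n) T.plus)
          (LinearMap.ker (barMap F M α β n) ⊓ F.barDeg n (d - l)) (T.plusDeg l) ⊔
        Submodule.map₂ (TensorProduct.mk k (F.bar n) T.plus) (F.barDeg n (d - l))
          (LinearMap.ker β ⊓ T.plusDeg l)) : Submodule k (F.bar n ⊗[k] T.plus)) :=
  ker_inf_tensorDeg (h.hasGradedSection n) h.section_plus d

/-- In a degree where both bar complexes are exact, the kernel of the covering map comes from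
lower degrees. -/
theorem ker_inf_deg {d : ℤ} (hF : F.ExactAt 0 d) (hM : M.ExactAt 1 d) :
    LinearMap.ker α ⊓ F.deg d =
      (LinearMap.ker (barMap F M α β 1) ⊓ F.barDeg 1 d).map (F.barD 0) := by
  apply le_antisymm
  · rintro x ⟨hx, hxd⟩
    obtain ⟨y, hy, rfl⟩ := hF x trivial hxd
    -- The image of `y` in `M ⊗ A₊` is a cycle because `F.barD 0 y` lies in `ker α`. It is therefore
    -- a boundary, which lifts to some `e` over `F`. Correcting `y` by the boundary of `e` moves it
    -- into the kernel without changing its own boundary.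
    have h₁ : M.barD 0 (barMap F M α β 1 y) = 0 := by
      rw [← h.barMap_barD_apply]
      exact hx
    obtain ⟨b, hb, hby⟩ := hM (barMap F M α β 1 y) h₁ ((h.hasGradedSection 1).1 d y hy)
    rw [← (h.hasGradedSection 2).map_eq] at hb
    obtain ⟨e, he, rfl⟩ := hb
    refine ⟨y - F.barD 1 e, ⟨?_, sub_mem hy (F.barD_mem 1 d e he)⟩, ?_⟩
    · rw [SetLike.mem_coe, LinearMap.mem_ker, map_sub, h.barMap_barD_apply, hby, sub_self]
    · have h₂ : F.barD 0 (F.barD 1 e) = 0 := LinearMap.congr_fun (F.barD_barD 0) e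
      rw [map_sub, h₂, sub_zero]
  · rintro _ ⟨y, ⟨hy, hyd⟩, rfl⟩
    refine ⟨?_, F.barD_mem 0 d y hyd⟩
    have := h.barMap_barD_apply 0 y
    rw [LinearMap.mem_ker.1 hy, map_zero] at this
    exact this

/-- The full preimage of the boundaries in the `n`-th space of the bar complex of the cover. -/
def preBoundary (_ : BarCover F M α β) (n : ℕ) (d : ℤ) : Submodule k (F.bar n) :=
  (F.barDeg (n + 1) d).map (F.barD n) ⊔ (LinearMap.ker (barMap F M α β n) ⊓ F.barDeg n d)

theorem preBoundary_le (n : ℕ) (d : ℤ) : h.preBoundary n d ≤ F.barDeg n d := by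
  refine sup_le ?_ inf_le_right
  rintro _ ⟨t, ht, rfl⟩
  exact F.barD_mem n d t ht

/-- Rank-nullity for `barMap` on `preBoundary`: the image is the space of boundaries of `M`, and the
kernel is the whole kernel of `barMap` in this degree, since `preBoundary` contains it. -/
theorem finrank_preBoundary (n : ℕ) (d : ℤ) [FiniteDimensional k (F.barDeg n d)] :
    Module.finrank k (h.preBoundary n d) =
      Module.finrank k ((M.barDeg (n + 1) d).map (M.barD n)) +
        Module.finrank k ↥(LinearMap.ker (barMap F M α β n) ⊓ F.barDeg n d) := by
  have : FiniteDimensional k (h.preBoundary n d) :=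
    Submodule.finiteDimensional_of_le (h.preBoundary_le n d)
  have h₁ : (h.preBoundary n d).map (barMap F M α β n) =
      (M.barDeg (n + 1) d).map (M.barD n) := by
    rw [preBoundary, Submodule.map_sup, ← Submodule.map_comp, h.barMap_barD, Submodule.map_comp,
      (h.hasGradedSection (n + 1)).map_eq]
    refine sup_eq_left.2 ?_
    rintro _ ⟨x, ⟨hx, -⟩, rfl⟩
    rw [SetLike.mem_coe, LinearMap.mem_ker] at hx
    rw [hx]
    exact zero_mem _
  have h₂ : LinearMap.ker (barMap F M α β n) ⊓ h.preBoundary n d =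
      LinearMap.ker (barMap F M α β n) ⊓ F.barDeg n d :=
    le_antisymm (inf_le_inf_left _ (h.preBoundary_le n d)) (le_inf inf_le_left le_sup_right)
  rw [← h₁, ← h₂]
  exact (finrank_map_add_finrank_ker_inf _ _).symm

theorem finrank_barDeg (n : ℕ) (d : ℤ) [FiniteDimensional k (F.barDeg n d)] :
    Module.finrank k (F.barDeg n d) = Module.finrank k (M.barDeg n d) +
      Module.finrank k ↥(LinearMap.ker (barMap F M α β n) ⊓ F.barDeg n d) := by
  rw [← finrank_map_add_finrank_ker_inf (barMap F M α β n) (F.barDeg n d),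
    (h.hasGradedSection n).map_eq]

theorem finiteDimensional_barDeg (n : ℕ) (d : ℤ) [FiniteDimensional k (F.barDeg n d)] :
    FiniteDimensional k (M.barDeg n d) := by
  rw [← (h.hasGradedSection n).map_eq]
  infer_instance

/-- By exactness the boundaries in place `n + 1` are the cycles there, so by rank-nullity the
boundaries in places `n` and `n + 1` have total dimension that of `M.barDeg (n + 1) d`. The kernels
of `barMap` account for the rest. With `n = 1` the right side is independent of `M`, and `M.barDeg 1
d` sees only components of `M` of degree below `d`. -/
theorem finrank_preBoundary_add [∀ n d, FiniteDimensional k (F.barDeg n d)] {n : ℕ} {d : ℤ}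
    (hM : M.ExactAt (n + 1) d) :
    Module.finrank k (h.preBoundary n d) + Module.finrank k (h.preBoundary (n + 1) d) +
        Module.finrank k (M.barDeg n d) =
      Module.finrank k (F.barDeg n d) + Module.finrank k (F.barDeg (n + 1) d) := by
  have := h.finiteDimensional_barDeg (n + 1) d
  have h₁ := h.finrank_preBoundary n d
  have h₂ := h.finrank_preBoundary (n + 1) d
  have h₃ := h.finrank_barDeg n d
  have h₄ := h.finrank_barDeg (n + 1) d
  have h₅ := M.finrank_map_barD_add n d
  rw [hM.map_barD_eq] at h₂
  omega

/-- Exactness at 0 and 1 makes `M_d` the quotient of `(M ⊗ A₊)_d` by its boundaries, and this is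
also the quotient of `(F ⊗ T₊)_d` by their full preimage. -/
theorem finrank_deg_add [∀ n d, FiniteDimensional k (F.barDeg n d)] {d : ℤ}
    (hM₀ : M.ExactAt 0 d) (hM : M.ExactAt 1 d) :
    Module.finrank k (M.barDeg 0 d) + Module.finrank k (h.preBoundary (0 + 1) d) =
      Module.finrank k (F.barDeg (0 + 1) d) := by
  have := h.finiteDimensional_barDeg (0 + 1) d
  have h₁ := h.finrank_preBoundary (0 + 1) d
  have h₃ := h.finrank_barDeg (0 + 1) d
  have h₅ := M.finrank_map_barD_add 0 d
  rw [ExactAt.map_barD_eq hM] at h₁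
  rw [hM₀.map_barD_zero_eq] at h₅
  omega

end BarCover

end GradedRightModule

/-! ### Projections onto components; the augmentation ideal as a graded module -/

section Components

variable {k ι X : Type*} [Field k] [AddCommGroup X] [Module k X] [DecidableEq ι]

/-- The projection of a graded space onto a homogeneous component. -/
def gradedProj (V : ι → Submodule k X) [DirectSum.Decomposition V] (i : ι) : X →ₗ[k] X :=
  (V i).subtype ∘ₗ DirectSum.component k ι (fun i => V i) i ∘ₗ
    (DirectSum.decomposeLinearEquiv V).toLinearMap

variable (V : ι → Submodule k X) [DirectSum.Decomposition V]

theorem gradedProj_apply (i : ι) (x : X) : gradedProj V i x = DirectSum.decompose V x i := rfl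

theorem gradedProj_mem (i : ι) (x : X) : gradedProj V i x ∈ V i :=
  (DirectSum.decompose V x i).2

theorem gradedProj_same {i : ι} {x : X} (hx : x ∈ V i) : gradedProj V i x = x :=
  DirectSum.decompose_of_mem_same V hx

theorem gradedProj_ne {i j : ι} {x : X} (hx : x ∈ V j) (h : i ≠ j) : gradedProj V i x = 0 :=
  DirectSum.decompose_of_mem_ne V hx h.symm

theorem mem_iSup_of_decomposition (x : X) : x ∈ ⨆ i, V i := by
  rw [(DirectSum.Decomposition.isInternal V).submodule_iSup_eq_top]
  trivial

/-- A space graded by the natural numbers as a space graded by the integers. -/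
def zExtend (W : ℕ → Submodule k X) : ℤ → Submodule k X
  | Int.ofNat l => W l
  | Int.negSucc _ => ⊥

theorem zExtend_of_neg (W : ℕ → Submodule k X) {i : ℤ} (hi : i < 0) : zExtend W i = ⊥ := by
  cases i with
  | ofNat l => exact absurd hi (by simp)
  | negSucc l => rfl

theorem isInternal_zExtend (W : ℕ → Submodule k X) [DirectSum.Decomposition W] :
    DirectSum.IsInternal (zExtend W) := by
  refine isInternal_of_projections (zExtend W)
    (fun i => match i with
      | Int.ofNat l => gradedProj W l
      | Int.negSucc _ => 0) ?_ ?_ ?_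
  · rintro (l | l) x hx
    · exact gradedProj_same W hx
    · exact ((Submodule.mem_bot k).1 hx).symm
  · rintro (l | l) (l' | l') h x hx
    · exact gradedProj_ne W hx fun e => h (congrArg _ e)
    · have hx : x = 0 := hx
      simp [hx]
    · rfl
    · rfl
  · intro x
    have h : (⨆ l, W l) ≤ ⨆ i, zExtend W i := iSup_le fun l => le_iSup (zExtend W) (l : ℤ)
    exact h (mem_iSup_of_decomposition W x)

instance (W : ℕ → Submodule k X) [DirectSum.Decomposition W] :
    DirectSum.Decomposition (zExtend W) :=
  (isInternal_zExtend W).chooseDecomposition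

end Components

namespace ConnGradedAlgebra

variable {k : Type u} [Field k] (A : ConnGradedAlgebra k)

theorem mem_plus_iff (x : A.carrier) : x ∈ A.plus ↔ A.aug x = 0 := Iff.rfl

theorem eq_algebraMap_of_mem {x : A.carrier} (hx : x ∈ A.deg 0) :
    x = algebraMap k A.carrier (A.aug x) := by
  obtain ⟨c, hc⟩ := A.connected.2 ⟨x, hx⟩
  have h : algebraMap k A.carrier c = x := congrArg Subtype.val hc
  rw [← h, aug_algebraMap]

theorem aug_gradedProj_zero (x : A.carrier) : A.aug (gradedProj A.deg 0 x) = A.aug x := by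
  induction x using DirectSum.Decomposition.inductionOn A.deg with
  | zero => simp
  | @homogeneous i x =>
    by_cases hi : i = 0
    · subst hi
      rw [gradedProj_same A.deg x.2]
    · rw [gradedProj_ne A.deg x.2 (Ne.symm hi), A.aug_of_mem hi x.2, map_zero]
  | add a b ha hb => simp only [map_add, ha, hb]

theorem gradedProj_mem_plus (i : ℕ) {x : A.carrier} (hx : x ∈ A.plus) :
    gradedProj A.deg i x ∈ A.plus := by
  rw [mem_plus_iff] at hx ⊢
  by_cases hi : i = 0
  · rw [hi, aug_gradedProj_zero, hx]
  · exact A.aug_of_mem hi (gradedProj_mem A.deg i x)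

theorem plusDeg_zero : A.plusDeg 0 = ⊥ := by
  refine (Submodule.eq_bot_iff _).2 fun x hx => Subtype.ext ?_
  have h : (x : A.carrier) ∈ A.deg 0 := hx
  rw [A.eq_algebraMap_of_mem h, (A.mem_plus_iff x).1 x.2, map_zero]
  rfl

open Classical in
theorem isInternal_plusDeg : DirectSum.IsInternal A.plusDeg := by
  refine isInternal_of_projections A.plusDeg
    (fun i => (gradedProj A.deg i).restrict fun x hx => A.gradedProj_mem_plus i hx) ?_ ?_ ?_
  · exact fun i x hx => Subtype.ext (gradedProj_same A.deg hx)
  · exact fun i j h x hx => Subtype.ext (gradedProj_ne A.deg hx h)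
  · intro x
    have h : x = ∑ i ∈ (DirectSum.decompose A.deg (x : A.carrier)).support,
        (⟨gradedProj A.deg i x, A.gradedProj_mem_plus i x.2⟩ : A.plus) := by
      apply Subtype.ext
      rw [Submodule.coe_sum]
      exact (DirectSum.sum_support_decompose A.deg (x : A.carrier)).symm
    rw [h]
    exact Submodule.sum_mem _ fun i _ =>
      Submodule.mem_iSup_of_mem i (gradedProj_mem A.deg i (x : A.carrier))

instance : DirectSum.Decomposition A.plusDeg := A.isInternal_plusDeg.chooseDecomposition

/-- The right action of `A` on its augmentation ideal. -/
@[reducible]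
def plusRightModule : Module (A.carrier)ᵐᵒᵖ A.plus where
  smul a x := ⟨x.1 * a.unop, by
    rw [mem_plus_iff, map_mul, (A.mem_plus_iff x).1 x.2, zero_mul]⟩
  one_smul x := Subtype.ext (mul_one x.1)
  mul_smul a b x := Subtype.ext (mul_assoc x.1 b.unop a.unop).symm
  smul_zero a := Subtype.ext (zero_mul a.unop)
  smul_add a x y := Subtype.ext (add_mul x.1 y.1 a.unop)
  add_smul a b x := Subtype.ext (mul_add x.1 a.unop b.unop)
  zero_smul x := Subtype.ext (mul_zero x.1)

/-- The augmentation ideal as a graded right module. -/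
def plusModule : GradedRightModule A where
  carrier := A.plus
  rightModule := A.plusRightModule
  isScalarTower :=
    let := A.plusRightModule
    ⟨fun c a x => Subtype.ext (mul_smul_comm c x.1 a.unop)⟩
  deg := zExtend A.plusDeg
  smul_mem := by
    rintro (l | l) j x a hx ha
    · exact SetLike.mul_mem_graded (A := A.deg) (show x.1 ∈ A.deg l from hx) ha
    · have hx : x = 0 := hx
      let := A.plusRightModule
      rw [hx, smul_zero]
      exact zero_mem _

/-- The bound 1, rather than 0, lets the induction for algebras close: in degree `d` only components
of the algebra of degree at most `d - 1` are needed. -/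
theorem plusModule_deg_eq_bot {i : ℤ} (hi : i < 1) : A.plusModule.deg i = ⊥ := by
  rcases lt_or_eq_of_le (Int.lt_add_one_iff.1 (show i < 0 + 1 from hi)) with h | rfl
  · exact zExtend_of_neg _ h
  · exact A.plusDeg_zero

end ConnGradedAlgebra

/-! ### From bounds on `m_i` to exactness, and the shift from `k` to `A₊` -/

namespace GradedRightModule

variable {k : Type u} [Field k] {A : ConnGradedAlgebra k}

/-- A nonzero `Tor` in degree `j` would rule out the conventional value 0 and put `j` among the
degrees whose supremum is `m_i`. -/
theorem exactAt_of_m_le {M : GradedRightModule A} {i : ℕ} {N : ℤ}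
    (h : M.m i ≤ ((N : ℝ) : EReal)) {j : ℤ} (hj : N < j) : M.ExactAt i j := by
  have hsub : Subsingleton (M.Tor i j) := by
    by_contra hn
    rw [not_subsingleton_iff_nontrivial] at hn
    have hall : ¬ ∀ j : ℤ, Subsingleton (M.Tor i j) := fun hs =>
      not_subsingleton_iff_nontrivial.2 hn (hs j)
    rw [m, if_neg hall] at h
    have h' := (le_sSup (s := {x : EReal | ∃ j : ℤ, Nontrivial (M.Tor i j) ∧
      x = ((j : ℝ) : EReal)}) ⟨j, hn, rfl⟩).trans h
    rw [EReal.coe_le_coe_iff, Int.cast_le] at h'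
    omega
  intro x hx hxd
  have h₁ := (Submodule.Quotient.subsingleton_iff).1 hsub
  have h₂ : (⟨x, hx, hxd⟩ : ↥(M.barCycles i ⊓ M.barDeg i j)) ∈
      ((M.barDeg (i + 1) j).map (M.barD i)).comap (M.barCycles i ⊓ M.barDeg i j).subtype := by
    rw [h₁]
    trivial
  exact h₂

end GradedRightModule

namespace ConnGradedAlgebra

variable {k : Type u} [Field k] (A : ConnGradedAlgebra k)

/-- The bar construction of the trivial module is that of the augmentation ideal, shifted. -/
def barShift : (n : ℕ) → A.trivialModule.bar (n + 1) ≃ₗ[k] A.plusModule.bar n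
  | 0 => (TensorProduct.lid k A.plus : k ⊗[k] A.plus ≃ₗ[k] A.plus)
  | n + 1 => (TensorProduct.congr (barShift n) (LinearEquiv.refl k A.plus) :
      A.trivialModule.bar (n + 1) ⊗[k] A.plus ≃ₗ[k] A.plusModule.bar n ⊗[k] A.plus)

theorem trivialModule_barD_zero : A.trivialModule.barD 0 = 0 := by
  have : TensorProduct.lift A.trivialModule.act = 0 := by
    refine TensorProduct.ext' fun (c : k) a => ?_
    change A.aug a.1 * c = 0
    rw [(A.mem_plus_iff a).1 a.2, zero_mul]
  exact this

/-- The shift moves every factor one place, so the alternating signs of the two complexes are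
opposite; anticommutation with the differentials passes from one place to the next. -/
theorem map_barStep_neg {X X' : Type u} [AddCommGroup X] [Module k X] [AddCommGroup X']
    [Module k X'] (s : k) (f : X →ₗ[k] X') (d : X ⊗[k] A.plus →ₗ[k] X)
    (d' : X' ⊗[k] A.plus →ₗ[k] X')
    (hd : f ∘ₗ d = -(d' ∘ₗ TensorProduct.map f LinearMap.id)) :
    TensorProduct.map f LinearMap.id ∘ₗ GradedRightModule.barStep A (-s) d =
      -(GradedRightModule.barStep A s d' ∘ₗ
        TensorProduct.map (TensorProduct.map f LinearMap.id) LinearMap.id) := by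
  apply TensorProduct.ext_threefold
  intro x a b
  have h : f (d (x ⊗ₜ a)) = -d' (f x ⊗ₜ a) := LinearMap.congr_fun hd (x ⊗ₜ a)
  simp only [LinearMap.comp_apply, GradedRightModule.barStep_tmul, TensorProduct.map_tmul, map_add,
    map_neg, map_smul, h, LinearMap.neg_apply, LinearMap.id_apply, TensorProduct.neg_tmul, neg_smul,
    neg_add]

/-- Since `A₊` acts by zero on `k`, the leading term of the differential disappears, and the first
product `a₁ a₂` becomes the action on `A₊`. -/
theorem barShift_barD : ∀ n, (A.barShift n).toLinearMap ∘ₗ A.trivialModule.barD (n + 1) =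
    -(A.plusModule.barD n ∘ₗ (A.barShift (n + 1)).toLinearMap)
  | 0 => by
    have : (TensorProduct.lid k A.plus).toLinearMap ∘ₗ
        GradedRightModule.barStep A ((-1) ^ (0 + 1)) (0 : k ⊗[k] A.plus →ₗ[k] k) =
        -(TensorProduct.lift A.plusMul ∘ₗ
          (TensorProduct.congr (TensorProduct.lid k A.plus)
            (LinearEquiv.refl k A.plus)).toLinearMap) := by
      apply TensorProduct.ext_threefold
      intro c a b
      rw [LinearMap.comp_apply, GradedRightModule.barStep_tmul]
      simp
      exact neg_one_smul k (c • A.plusMul a b)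
    have e : A.trivialModule.barD (0 + 1) = GradedRightModule.barStep A
      (X := A.trivialModule.bar 0) ((-1) ^ (0 + 1)) (A.trivialModule.barD 0) := rfl
    rw [e, trivialModule_barD_zero]
    exact this
  | n + 1 => by
    have := A.map_barStep_neg (X := A.trivialModule.bar (n + 1)) (X' := A.plusModule.bar n)
      ((-1) ^ (n + 1)) (A.barShift n).toLinearMap (A.trivialModule.barD (n + 1))
      (A.plusModule.barD n) (barShift_barD n)
    have e : (-1 : k) ^ (n + 1 + 1) = -(-1) ^ (n + 1) := by rw [pow_succ, mul_neg_one]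
    rw [← e] at this
    exact this

theorem barShift_mem : ∀ (n : ℕ) (j : ℤ), ∀ t ∈ A.trivialModule.barDeg (n + 1) j,
    A.barShift n t ∈ A.plusModule.barDeg n j
  | 0, j => by
    suffices h : tensorDeg A.trivialModule.deg A.plusDeg j ≤
        (zExtend A.plusDeg j).comap (TensorProduct.lid k A.plus).toLinearMap from fun t ht => h ht
    refine tensorDeg_le fun l (c : k) hc a ha => ?_
    change c • a ∈ zExtend A.plusDeg j
    by_cases hj : j - l = 0
    · obtain rfl : j = l := by omega
      exact Submodule.smul_mem _ _ ha
    · have hc : c ∈ (if j - l = 0 then ⊤ else ⊥ : Submodule k k) := hc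
      rw [if_neg hj, Submodule.mem_bot] at hc
      rw [hc, zero_smul]
      exact zero_mem _
  | n + 1, j => fun t ht => tensorDeg_map_le (V := A.trivialModule.barDeg (n + 1))
      (V' := A.plusModule.barDeg n) (f := (A.barShift n).toLinearMap) (g := LinearMap.id)
      (fun l x hx y hy => tmul_mem_tensorDeg (barShift_mem n _ x hx) hy) ht

theorem barShift_symm_mem : ∀ (n : ℕ) (j : ℤ), ∀ t ∈ A.plusModule.barDeg n j,
    (A.barShift n).symm t ∈ A.trivialModule.barDeg (n + 1) j
  | 0, Int.ofNat l => fun t ht => by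
    have h : (1 : k) ⊗ₜ[k] (t : A.plus) ∈ tensorDeg A.trivialModule.deg A.plusDeg (l : ℤ) := by
      refine tmul_mem_tensorDeg (l := l) ?_ ht
      change (1 : k) ∈ (if (l : ℤ) - l = 0 then ⊤ else ⊥ : Submodule k k)
      rw [if_pos (sub_self _)]
      trivial
    exact h
  | 0, Int.negSucc l => fun t ht => by
    have ht : t = 0 := ht
    rw [ht, map_zero]
    exact zero_mem _
  | n + 1, j => fun t ht => tensorDeg_map_le (V' := A.trivialModule.barDeg (n + 1))
      (V := A.plusModule.barDeg n) (f := (A.barShift n).symm.toLinearMap) (g := LinearMap.id)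
      (fun l x hx y hy => tmul_mem_tensorDeg (barShift_symm_mem n _ x hx) hy) ht

theorem barShift_symm_mem_barCycles : ∀ (n : ℕ), ∀ t ∈ A.plusModule.barCycles n,
    (A.barShift n).symm t ∈ A.trivialModule.barCycles (n + 1)
  | 0 => fun t _ => by
    change A.trivialModule.barD 0 _ = 0
    rw [trivialModule_barD_zero]
    rfl
  | n + 1 => fun t ht => by
    change A.trivialModule.barD (n + 1) _ = 0
    have h := LinearMap.congr_fun (A.barShift_barD n) ((A.barShift (n + 1)).symm t)
    have ht : A.plusModule.barD n t = 0 := ht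
    simp only [LinearMap.comp_apply, LinearEquiv.coe_coe, LinearMap.neg_apply,
      LinearEquiv.apply_symm_apply, ht, neg_zero] at h
    exact (LinearEquiv.map_eq_zero_iff _).1 h

/-- This is the dimension shift `Tor_{n+1}(k, k) = Tor_n(A₊, k)`; the sign in the preimage
compensates the anticommutation in `barShift_barD`. -/
theorem exactAt_plusModule {n : ℕ} {j : ℤ} (h : A.trivialModule.ExactAt (n + 1) j) :
    A.plusModule.ExactAt n j := by
  intro x hx hxd
  obtain ⟨y, hy, hyx⟩ := h _ (A.barShift_symm_mem_barCycles n x hx) (A.barShift_symm_mem n j x hxd)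
  refine ⟨-A.barShift (n + 1) y, neg_mem (A.barShift_mem (n + 1) j y hy), ?_⟩
  have h := LinearMap.congr_fun (A.barShift_barD n) y
  simp only [LinearMap.comp_apply, LinearEquiv.coe_coe, LinearMap.neg_apply, hyx,
    LinearEquiv.apply_symm_apply] at h
  rw [map_neg, ← h]

end ConnGradedAlgebra

/-! ### Families of quotients: regularity of relations and constancy of dimensions -/

namespace GradedRightModule

section Families

variable {k : Type u} [Field k] {P : Type*} {S : Subalgebra k (P → k)} {T : ConnGradedAlgebra k}
  {A : P → ConnGradedAlgebra k} {F : GradedRightModule T} {M : ∀ z, GradedRightModule (A z)}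
  {α : ∀ z, F.carrier →ₗ[k] (M z).carrier} {β : ∀ z, T.plus →ₗ[k] (A z).plus}

/-- The kernel of a tensor product of maps is assembled from the kernels of the factors. As `T₊`
starts in degree 1 and `F` in degree `p`, only kernels of `α` below `d` and kernels of `β` up to `d
- p` enter. -/
theorem regularFamily_ker_barMap (h : ∀ z, BarCover F (M z) (α z) (β z)) {p : ℤ}
    (hF : ∀ i < p, F.deg i = ⊥) (n : ℕ) : ∀ d : ℤ,
    (∀ i < d, RegularFamily S fun z => LinearMap.ker (α z) ⊓ F.deg i) →
    (∀ l : ℕ, 1 ≤ l → (l : ℤ) ≤ d - p →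
      RegularFamily S fun z => LinearMap.ker (β z) ⊓ T.plusDeg l) →
    RegularFamily S fun z =>
      LinearMap.ker (barMap F (M z) (α z) (β z) (n + 1)) ⊓ F.barDeg (n + 1) d := by
  have key : ∀ (n : ℕ) (d : ℤ),
      (∀ l : ℕ, 1 ≤ l → RegularFamily S fun z =>
        LinearMap.ker (barMap F (M z) (α z) (β z) n) ⊓ F.barDeg n (d - l)) →
      (∀ l : ℕ, 1 ≤ l → (l : ℤ) ≤ d - p →
        RegularFamily S fun z => LinearMap.ker (β z) ⊓ T.plusDeg l) →
      RegularFamily S fun z =>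
        LinearMap.ker (barMap F (M z) (α z) (β z) (n + 1)) ⊓ F.barDeg (n + 1) d := by
    intro n d hK hI
    refine RegularFamily.congr ?_ fun z => ((h z).ker_inf_barDeg_succ n d).symm
    refine RegularFamily.iSup fun l => ?_
    rcases Nat.eq_zero_or_pos l with rfl | hl
    · simp only [T.plusDeg_zero, inf_bot_eq, Submodule.map₂_bot_right]
      exact regularFamily_const _
    · refine ((hK l hl).map₂_left _ _).sup ?_
      by_cases hlp : (l : ℤ) ≤ d - p
      · exact (hI l hl hlp).map₂_right _ _
      · simp only [F.barDeg_eq_bot hF n (d - l) (by omega), Submodule.map₂_bot_left]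
        exact regularFamily_const _
  induction n with
  | zero => exact fun d hJ hI => key 0 d (fun l hl => hJ _ (by omega)) hI
  | succ n ih =>
    exact fun d hJ hI => key (n + 1) d (fun l hl => ih _ (fun i hi => hJ i (by omega))
      fun l' hl' hlp => hI l' hl' (by omega)) hI

/-- Regularity of the relations in a degree where the relations come from lower degrees. -/
theorem regularFamily_ker_deg (h : ∀ z, BarCover F (M z) (α z) (β z)) {p : ℤ}
    (hF : ∀ i < p, F.deg i = ⊥) {d : ℤ}
    (hJ : ∀ i < d, RegularFamily S fun z => LinearMap.ker (α z) ⊓ F.deg i)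
    (hI : ∀ l : ℕ, 1 ≤ l → (l : ℤ) ≤ d - p →
      RegularFamily S fun z => LinearMap.ker (β z) ⊓ T.plusDeg l)
    (hF₀ : F.ExactAt 0 d) (hM₁ : ∀ z, (M z).ExactAt 1 d) :
    RegularFamily S fun z => LinearMap.ker (α z) ⊓ F.deg d :=
  ((regularFamily_ker_barMap h hF 0 d hJ hI).map (F.barD 0)).congr
    fun z => ((h z).ker_inf_deg hF₀ (hM₁ z)).symm

theorem regularFamily_preBoundary (h : ∀ z, BarCover F (M z) (α z) (β z)) {p : ℤ}
    (hF : ∀ i < p, F.deg i = ⊥) {d : ℤ}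
    (hJ : ∀ i < d, RegularFamily S fun z => LinearMap.ker (α z) ⊓ F.deg i)
    (hI : ∀ l : ℕ, 1 ≤ l → (l : ℤ) ≤ d - p →
      RegularFamily S fun z => LinearMap.ker (β z) ⊓ T.plusDeg l) (n : ℕ) :
    RegularFamily S fun z => (h z).preBoundary (n + 1) d :=
  (regularFamily_const _).sup (regularFamily_ker_barMap h hF n d hJ hI)

/-- Constancy of the dimension of a homogeneous component along an irreducible set, given the
constancy in lower degrees. -/
theorem finrank_deg_eq_of_irreducibleFor (h : ∀ z, BarCover F (M z) (α z) (β z)) {p : ℤ}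
    (hF : ∀ i < p, F.deg i = ⊥) [hFf : ∀ i, FiniteDimensional k (F.deg i)]
    [hTf : ∀ l, FiniteDimensional k (T.plusDeg l)] {d : ℤ}
    (hJ : ∀ i < d, RegularFamily S fun z => LinearMap.ker (α z) ⊓ F.deg i)
    (hI : ∀ l : ℕ, 1 ≤ l → (l : ℤ) ≤ d - p →
      RegularFamily S fun z => LinearMap.ker (β z) ⊓ T.plusDeg l)
    (hM₀ : ∀ z, (M z).ExactAt 0 d) (hM₁ : ∀ z, (M z).ExactAt 1 d)
    (hM₂ : ∀ z, (M z).ExactAt 2 d) {Z : Set P} (hZ : IrreducibleFor S Z)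
    (hdM : ∀ i < d, ∀ z ∈ Z, ∀ z' ∈ Z,
      Module.finrank k ((M z).deg i) = Module.finrank k ((M z').deg i))
    (hdA : ∀ l : ℕ, 1 ≤ l → (l : ℤ) ≤ d - p → ∀ z ∈ Z, ∀ z' ∈ Z,
      Module.finrank k ((A z).plusDeg l) = Module.finrank k ((A z').plusDeg l))
    {z z' : P} (hz : z ∈ Z) (hz' : z' ∈ Z) :
    Module.finrank k ((M z).deg d) = Module.finrank k ((M z').deg d) := by
  have hfin : ∀ n d, FiniteDimensional k (F.barDeg n d) :=
    F.finiteDimensional_barDeg hF hFf hTf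
  have hMfin : ∀ z i, FiniteDimensional k ((M z).deg i) := fun z i => by
    rw [← (h z).section_module.map_eq]
    infer_instance
  have hAfin : ∀ z l, FiniteDimensional k ((A z).plusDeg l) := fun z l => by
    rw [← (h z).section_plus.map_eq]
    infer_instance
  have hMbot : ∀ z, ∀ i < p, (M z).deg i = ⊥ := fun z i hi => by
    rw [← (h z).section_module.map_eq, hF i hi, Submodule.map_bot]
  have hpre : ∀ n z, FiniteDimensional k ((h z).preBoundary n d) := fun n z =>
    Submodule.finiteDimensional_of_le ((h z).preBoundary_le n d)
  -- The components of `M ⊗ A₊` in degree `d` use lower degrees of `M`, so their dimension is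
  -- constant along `Z` by assumption.
  have hle : ∀ z ∈ Z, ∀ z' ∈ Z, Module.finrank k ((M z).barDeg (0 + 1) d) ≤
      Module.finrank k ((M z').barDeg (0 + 1) d) := by
    intro z hz z' hz'
    have : FiniteDimensional k (tensorDeg (M z').deg (A z').plusDeg d) :=
      (h z').finiteDimensional_barDeg 1 d
    refine finrank_tensorDeg_le (V := (M z).deg) (W := (A z).plusDeg) (V' := (M z').deg)
      (W' := (A z').plusDeg) fun l => ?_
    rcases Nat.eq_zero_or_pos l with rfl | hl
    · exact Or.inr (Or.inl (A z).plusDeg_zero)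
    · by_cases hlp : (l : ℤ) ≤ d - p
      · exact Or.inr (Or.inr ⟨(hdM _ (by omega) z hz z' hz').le, (hdA l hl hlp z hz z' hz').le⟩)
      · exact Or.inl (hMbot z _ (by omega))
  have hB : ∀ z ∈ Z, ∀ z' ∈ Z, Module.finrank k ((M z).barDeg (0 + 1) d) =
      Module.finrank k ((M z').barDeg (0 + 1) d) := fun z hz z' hz' =>
    le_antisymm (hle z hz z' hz') (hle z' hz' z hz)
  -- Semicontinuity is applied to the preimages of boundaries in places 1 and 2, whose dimensions
  -- have constant sum by exactness at 2.
  have hU := hZ.finrank_eq (regularFamily_preBoundary h hF hJ hI 0)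
    (regularFamily_preBoundary h hF hJ hI (0 + 1)) (fun z hz z' hz' => by
      have h₁ := (h z).finrank_preBoundary_add (n := 0 + 1) (d := d) (hM₂ z)
      have h₂ := (h z').finrank_preBoundary_add (n := 0 + 1) (d := d) (hM₂ z')
      have h₃ := hB z hz z' hz'
      omega) hz hz'
  have h₁ := (h z).finrank_deg_add (hM₀ z) (hM₁ z)
  have h₂ := (h z').finrank_deg_add (hM₀ z') (hM₁ z')
  have h₃ : Module.finrank k ((M z).barDeg 0 d) = Module.finrank k ((M z').barDeg 0 d) := by
    omega
  exact h₃

/-- Relations that are regular up to some degree are regular in all degrees. -/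
theorem regularFamily_ker_of_le (h : ∀ z, BarCover F (M z) (α z) (β z)) {p N : ℤ}
    (hF : ∀ i < p, F.deg i = ⊥) (hF₀ : ∀ d, N < d → F.ExactAt 0 d)
    (hM₁ : ∀ z, ∀ d, N < d → (M z).ExactAt 1 d)
    (hJ : ∀ d ≤ N, RegularFamily S fun z => LinearMap.ker (α z) ⊓ F.deg d)
    (hI : ∀ d, N < d → (∀ i < d, RegularFamily S fun z => LinearMap.ker (α z) ⊓ F.deg i) →
      ∀ l : ℕ, 1 ≤ l → (l : ℤ) ≤ d - p →
        RegularFamily S fun z => LinearMap.ker (β z) ⊓ T.plusDeg l) (d : ℤ) :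
    RegularFamily S fun z => LinearMap.ker (α z) ⊓ F.deg d := by
  -- The induction is on the excess over `N`. The hypothesis `hI` receives the regularity already
  -- obtained below `d`, because for algebras the relations of `T₊` are the very family being
  -- treated.
  have key : ∀ (e : ℕ) (d : ℤ), d ≤ N + e →
      RegularFamily S fun z => LinearMap.ker (α z) ⊓ F.deg d := by
    intro e
    induction e with
    | zero => exact fun d hd => hJ d (by simpa using hd)
    | succ e ih =>
      intro d hd
      by_cases hdN : d ≤ N
      · exact hJ d hdN
      · have hlow := fun i (hi : i < d) => ih i (by push_cast at hd; omega)
        exact regularFamily_ker_deg h hF hlow (hI d (by omega) hlow) (hF₀ d (by omega))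
          fun z => hM₁ z d (by omega)
  exact key (d - N).toNat d (by omega)

/-- Dimensions that are constant up to some degree along an irreducible set are constant in all
degrees. -/
theorem finrank_deg_eq_of_le (h : ∀ z, BarCover F (M z) (α z) (β z)) {p N : ℤ}
    (hF : ∀ i < p, F.deg i = ⊥) [hFf : ∀ i, FiniteDimensional k (F.deg i)]
    [hTf : ∀ l, FiniteDimensional k (T.plusDeg l)]
    (hJ : ∀ i, RegularFamily S fun z => LinearMap.ker (α z) ⊓ F.deg i)
    (hI : ∀ l : ℕ, 1 ≤ l → RegularFamily S fun z => LinearMap.ker (β z) ⊓ T.plusDeg l)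
    (hM : ∀ z, ∀ d, N < d → (M z).ExactAt 0 d ∧ (M z).ExactAt 1 d ∧ (M z).ExactAt 2 d)
    {Z : Set P} (hZ : IrreducibleFor S Z)
    (hdM : ∀ i ≤ N, ∀ z ∈ Z, ∀ z' ∈ Z,
      Module.finrank k ((M z).deg i) = Module.finrank k ((M z').deg i))
    (hdA : ∀ d, N < d → (∀ i < d, ∀ z ∈ Z, ∀ z' ∈ Z,
      Module.finrank k ((M z).deg i) = Module.finrank k ((M z').deg i)) →
      ∀ l : ℕ, 1 ≤ l → (l : ℤ) ≤ d - p → ∀ z ∈ Z, ∀ z' ∈ Z,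
        Module.finrank k ((A z).plusDeg l) = Module.finrank k ((A z').plusDeg l)) (d : ℤ) :
    ∀ z ∈ Z, ∀ z' ∈ Z, Module.finrank k ((M z).deg d) = Module.finrank k ((M z').deg d) := by
  have key : ∀ (e : ℕ) (d : ℤ), d ≤ N + e → ∀ z ∈ Z, ∀ z' ∈ Z,
      Module.finrank k ((M z).deg d) = Module.finrank k ((M z').deg d) := by
    intro e
    induction e with
    | zero => exact fun d hd => hdM d (by simpa using hd)
    | succ e ih =>
      intro d hd z hz z' hz'
      by_cases hdN : d ≤ N
      · exact hdM d hdN z hz z' hz'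
      · have hlow := fun i (hi : i < d) => ih i (by push_cast at hd; omega)
        exact finrank_deg_eq_of_irreducibleFor h hF (fun i _ => hJ i) (fun l hl _ => hI l hl)
          (fun z => (hM z d (by omega)).1) (fun z => (hM z d (by omega)).2.1)
          (fun z => (hM z d (by omega)).2.2) hZ hlow (hdA d (by omega) hlow) hz hz'
  exact key (d - N).toNat d (by omega)

end Families

end GradedRightModule

/-! ### Free graded algebras -/

section Components

variable {k ι X X' : Type*} [Field k] [AddCommGroup X] [Module k X] [AddCommGroup X'] [Module k X']
  [DecidableEq ι] (V : ι → Submodule k X) [DirectSum.Decomposition V]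
  (V' : ι → Submodule k X') [DirectSum.Decomposition V']

theorem map_gradedProj {f : X →ₗ[k] X'} (hf : ∀ i, ∀ x ∈ V i, f x ∈ V' i) (i : ι) (x : X) :
    f (gradedProj V i x) = gradedProj V' i (f x) := by
  induction x using DirectSum.Decomposition.inductionOn V with
  | zero => simp
  | @homogeneous j x =>
    by_cases h : i = j
    · subst h
      rw [gradedProj_same V x.2, gradedProj_same V' (hf _ _ x.2)]
    · rw [gradedProj_ne V x.2 h, gradedProj_ne V' (hf _ _ x.2) h, map_zero]
  | add a b ha hb => simp only [map_add, ha, hb]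

theorem exists_mem_of_mem_range {f : X →ₗ[k] X'} (hf : ∀ i, ∀ x ∈ V i, f x ∈ V' i) {i : ι}
    {y : X'} (hy : y ∈ V' i) (hyf : y ∈ LinearMap.range f) : ∃ x ∈ V i, f x = y := by
  obtain ⟨x, rfl⟩ := hyf
  exact ⟨gradedProj V i x, gradedProj_mem V i x,
    (map_gradedProj V V' hf i x).trans (gradedProj_same V' hy)⟩

end Components

section FreeAlgebra

variable (k : Type u) [Field k] {X : Type} (w : X → ℕ)

/-- The weight of a word in letters of given weights. -/
def wordWeight : FreeAddMonoid X →+ ℕ := FreeAddMonoid.lift w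

variable {w}

theorem wordWeight_of_add (x : X) (u : FreeAddMonoid X) :
    wordWeight w (FreeAddMonoid.of x + u) = w x + wordWeight w u := by
  rw [map_add]
  rfl

theorem eq_zero_of_wordWeight (hw : ∀ x, 1 ≤ w x) {u : FreeAddMonoid X}
    (hu : wordWeight w u = 0) : u = 0 := by
  induction u using FreeAddMonoid.inductionOn' with
  | zero => rfl
  | of_add x u _ =>
    rw [wordWeight_of_add] at hu
    have := hw x
    omega

theorem length_le_wordWeight (hw : ∀ x, 1 ≤ w x) (u : FreeAddMonoid X) :
    u.toList.length ≤ wordWeight w u := by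
  induction u using FreeAddMonoid.inductionOn' with
  | zero => exact Nat.zero_le _
  | of_add x u ih =>
    rw [wordWeight_of_add, FreeAddMonoid.toList_add, List.length_append,
      FreeAddMonoid.toList_of, List.length_singleton]
    have := hw x
    omega

theorem gradeBy_wordWeight_le_span (d : ℕ) :
    AddMonoidAlgebra.gradeBy k (wordWeight w) d ≤
      Submodule.span k (AddMonoidAlgebra.of' k (FreeAddMonoid X) '' {u | wordWeight w u = d}) :=
  fun f hf => Submodule.span_mono (Set.image_mono fun u hu => hf u hu)
    (AddMonoidAlgebra.mem_span_support_coeff f)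

/-- The free algebra on letters of given positive degrees. -/
def freeGradedAlgebra (hw : ∀ x, 1 ≤ w x) : ConnGradedAlgebra k where
  carrier := AddMonoidAlgebra k (FreeAddMonoid X)
  deg := AddMonoidAlgebra.gradeBy k (wordWeight w)
  graded := AddMonoidAlgebra.gradeBy.gradedAlgebra (wordWeight w)
  connected := by
    constructor
    · intro a b hab
      have h : algebraMap k (AddMonoidAlgebra k (FreeAddMonoid X)) a =
          algebraMap k (AddMonoidAlgebra k (FreeAddMonoid X)) b := congrArg Subtype.val hab
      exact FaithfulSMul.algebraMap_injective _ _ h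
    · rintro ⟨x, hx⟩
      have h := gradeBy_wordWeight_le_span k 0 hx
      have e : {u : FreeAddMonoid X | wordWeight w u = 0} = {0} := by
        ext u
        exact ⟨fun hu => eq_zero_of_wordWeight hw hu, fun hu => by
          rw [Set.mem_singleton_iff] at hu
          rw [Set.mem_ofPred_eq, hu, map_zero]⟩
      rw [e, Set.image_singleton, Submodule.mem_span_singleton] at h
      obtain ⟨c, rfl⟩ := h
      refine ⟨c, Subtype.ext ?_⟩
      exact Algebra.algebraMap_eq_smul_one c

variable {k} (hw : ∀ x, 1 ≤ w x)

/-- A word as an element of the free algebra. -/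
def freeGradedAlgebra.word (u : FreeAddMonoid X) : (freeGradedAlgebra k hw).carrier :=
  AddMonoidAlgebra.of' k (FreeAddMonoid X) u

namespace freeGradedAlgebra

theorem word_mem (u : FreeAddMonoid X) : word hw u ∈ (freeGradedAlgebra k hw).deg (wordWeight w u) :=
  AddMonoidAlgebra.single_mem_gradeBy (wordWeight w) u 1

theorem word_add (u v : FreeAddMonoid X) :
    (word hw (u + v) : (freeGradedAlgebra k hw).carrier) = word hw u * word hw v := by
  refine Eq.symm ((AddMonoidAlgebra.single_mul_single u v (1 : k) 1).trans ?_)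
  rw [mul_one]
  rfl

theorem deg_le_span (d : ℕ) : (freeGradedAlgebra k hw).deg d ≤
    Submodule.span k (word hw '' {u | wordWeight w u = d}) :=
  gradeBy_wordWeight_le_span k d

/-- All letters have positive weight, so a word of weight `d` has length at most `d`; over a finite
alphabet there are finitely many. -/
theorem finiteDimensional_deg [Finite X] (d : ℕ) :
    FiniteDimensional k ((freeGradedAlgebra k hw).deg d) := by
  have hfin : {u : FreeAddMonoid X | wordWeight w u = d}.Finite :=
    (List.finite_length_le X d).subset fun u hu => (length_le_wordWeight hw u).trans (le_of_eq hu)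
  have := FiniteDimensional.span_of_finite k
    (hfin.image (word hw : _ → (freeGradedAlgebra k hw).carrier))
  exact Submodule.finiteDimensional_of_le (deg_le_span hw d)

theorem word_mem_plus {u : FreeAddMonoid X} (hu : wordWeight w u ≠ 0) :
    word hw u ∈ (freeGradedAlgebra k hw).plus :=
  (freeGradedAlgebra k hw).aug_of_mem hu (word_mem hw u)

/-- A word heavier than every letter is its first letter times a nonempty word, hence a product of
two elements of `T₊`. -/
theorem exactAt_zero {N : ℕ} (hN : ∀ x, w x ≤ N) {d : ℤ} (hd : (N : ℤ) < d) :
    (freeGradedAlgebra k hw).plusModule.ExactAt 0 d := by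
  set T := freeGradedAlgebra k hw
  obtain ⟨l, rfl⟩ := Int.eq_ofNat_of_zero_le (show 0 ≤ d by omega)
  intro y _ hy
  have hy : (y : T.plus) ∈ T.plusDeg l := hy
  suffices h : T.deg l ≤ ((T.plusModule.barDeg 1 l).map (T.plusModule.barD 0)).map
      T.plus.subtype by
    obtain ⟨y', ⟨t, ht, rfl⟩, hty⟩ := h hy
    exact ⟨t, ht, Subtype.ext hty⟩
  refine (deg_le_span hw l).trans (Submodule.span_le.2 ?_)
  rintro _ ⟨u, hu, rfl⟩
  have hu : wordWeight w u = l := hu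
  induction u using FreeAddMonoid.inductionOn' with
  | zero =>
    rw [map_zero] at hu
    omega
  | of_add x u _ =>
    have hx : wordWeight w (FreeAddMonoid.of x) = w x := rfl
    rw [wordWeight_of_add] at hu
    have h₁ := hN x
    have h₂ := hw x
    let a : T.plus := ⟨word hw (FreeAddMonoid.of x), word_mem_plus hw (by omega)⟩
    let b : T.plus := ⟨word hw u, word_mem_plus hw (by omega)⟩
    have ha : a ∈ zExtend T.plusDeg ((l : ℤ) - (wordWeight w u : ℕ)) := by
      have e : (l : ℤ) - (wordWeight w u : ℕ) = (w x : ℕ) := by omega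
      rw [e]
      exact word_mem hw (FreeAddMonoid.of x)
    have hb : b ∈ T.plusDeg (wordWeight w u) := word_mem hw u
    have hab : a ⊗ₜ[k] b ∈ tensorDeg (zExtend T.plusDeg) T.plusDeg l := tmul_mem_tensorDeg ha hb
    have h : T.plusMul a b ∈ (T.plusModule.barDeg 1 l).map (T.plusModule.barD 0) :=
      ⟨a ⊗ₜ[k] b, hab, rfl⟩
    exact ⟨T.plusMul a b, h, (word_add hw (FreeAddMonoid.of x) u).symm⟩

variable {A : ConnGradedAlgebra k}

/-- The homomorphism from the free algebra with given values on the letters. -/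
def lift (f : X → A.carrier) : (freeGradedAlgebra k hw).carrier →ₐ[k] A.carrier :=
  AddMonoidAlgebra.lift k A.carrier (FreeAddMonoid X)
    (AddMonoidHom.toMultiplicativeLeft (FreeAddMonoid.lift fun x => Additive.ofMul (f x)))

theorem lift_word_of_add (f : X → A.carrier) (x : X) (u : FreeAddMonoid X) :
    lift hw f (word hw (FreeAddMonoid.of x + u)) = f x * lift hw f (word hw u) := by
  rw [word_add, map_mul]
  congr 1
  refine (AddMonoidAlgebra.lift_of' _ _).trans ?_
  rfl

theorem lift_mem {f : X → A.carrier} (hf : ∀ x, f x ∈ A.deg (w x)) (d : ℕ) :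
    ∀ t ∈ (freeGradedAlgebra k hw).deg d, lift hw f t ∈ A.deg d := by
  suffices h : (freeGradedAlgebra k hw).deg d ≤ (A.deg d).comap (lift hw f).toLinearMap from
    fun t ht => h ht
  refine (deg_le_span hw d).trans (Submodule.span_le.2 ?_)
  rintro _ ⟨u, rfl, rfl⟩
  change lift hw f (word hw u) ∈ A.deg (wordWeight w u)
  induction u using FreeAddMonoid.inductionOn' with
  | zero =>
    rw [map_zero]
    have : (word hw 0 : (freeGradedAlgebra k hw).carrier) = 1 := rfl
    rw [this, map_one]
    exact SetLike.one_mem_graded A.deg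
  | of_add x u ih =>
    rw [lift_word_of_add, wordWeight_of_add]
    exact SetLike.mul_mem_graded (hf x) ih

theorem mem_range_lift (f : X → A.carrier) (x : X) : f x ∈ (lift hw f).range := by
  refine ⟨word hw (FreeAddMonoid.of x), ?_⟩
  have h := lift_word_of_add (k := k) hw f x 0
  have h1 : (word hw 0 : (freeGradedAlgebra k hw).carrier) = 1 := rfl
  rw [add_zero, h1, map_one, mul_one] at h
  exact h

end freeGradedAlgebra

end FreeAlgebra

/-! ### Graded surjections and the universal cover of the algebras -/

namespace ConnGradedAlgebra

variable {k : Type u} [Field k] {T A : ConnGradedAlgebra k}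

/-- A graded algebra homomorphism that is surjective in each degree. -/
structure IsGradedSurjection (φ : T.carrier →ₐ[k] A.carrier) : Prop where
  map_mem : ∀ i, ∀ x ∈ T.deg i, φ x ∈ A.deg i
  surj : ∀ i, ∀ y ∈ A.deg i, ∃ x ∈ T.deg i, φ x = y

theorem IsGradedSurjection.aug_apply {φ : T.carrier →ₐ[k] A.carrier} (hφ : IsGradedSurjection φ)
    (t : T.carrier) : A.aug (φ t) = T.aug t := by
  have h₁ : φ (gradedProj T.deg 0 t) = gradedProj A.deg 0 (φ t) :=
    map_gradedProj T.deg A.deg (f := φ.toLinearMap) hφ.map_mem 0 t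
  rw [← T.aug_gradedProj_zero, ← A.aug_gradedProj_zero, ← h₁,
    T.eq_algebraMap_of_mem (gradedProj_mem T.deg 0 t), AlgHom.commutes, aug_algebraMap,
    aug_algebraMap]

/-- The map of augmentation ideals given by a graded surjection. -/
def IsGradedSurjection.plusMap {φ : T.carrier →ₐ[k] A.carrier} (hφ : IsGradedSurjection φ) :
    T.plus →ₗ[k] A.plus :=
  φ.toLinearMap.restrict fun x hx => by
    rw [mem_plus_iff] at hx ⊢
    exact (hφ.aug_apply x).trans hx

theorem IsGradedSurjection.hasGradedSection {φ : T.carrier →ₐ[k] A.carrier}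
    (hφ : IsGradedSurjection φ) : HasGradedSection T.plusDeg A.plusDeg hφ.plusMap := by
  refine hasGradedSection_of_surjective _ _ _ (fun i x hx => hφ.map_mem i x hx) fun i y hy => ?_
  obtain ⟨x, hx, hxy⟩ := hφ.surj i y hy
  exact ⟨⟨x, (hφ.aug_apply x).symm.trans (by rw [hxy]; exact y.2)⟩, hx, Subtype.ext hxy⟩

theorem IsGradedSurjection.barCover {φ : T.carrier →ₐ[k] A.carrier} (hφ : IsGradedSurjection φ) :
    GradedRightModule.BarCover T.plusModule A.plusModule hφ.plusMap hφ.plusMap where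
  section_module := by
    refine hasGradedSection_of_surjective (zExtend T.plusDeg) (zExtend A.plusDeg) hφ.plusMap ?_ ?_
    · rintro (i | i) x hx
      · exact hφ.hasGradedSection.1 i x hx
      · have hx : x = 0 := hx
        rw [hx, map_zero]
        exact zero_mem _
    · rintro (i | i) y hy
      · obtain ⟨-, s, hs, hs'⟩ := hφ.hasGradedSection
        exact ⟨s y, hs' i y hy, LinearMap.congr_fun hs y⟩
      · have hy : y = 0 := hy
        exact ⟨0, zero_mem _, by rw [hy, map_zero]⟩
  section_plus := hφ.hasGradedSection
  map_act x a := Subtype.ext (map_mul φ x.1 a.1)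
  map_mul a b := Subtype.ext (map_mul φ a.1 b.1)

theorem gradedProj_mul (a b : A.carrier) (e : ℕ) :
    gradedProj A.deg e (a * b) =
      ∑ ij ∈ Finset.HasAntidiagonal.antidiagonal e, gradedProj A.deg ij.1 a * gradedProj A.deg ij.2 b := by
  simp only [gradedProj_apply]
  rw [DirectSum.decompose_mul, DirectSum.coe_mul_apply_eq_sum_antidiagonal]

/-- A subalgebra contains all homogeneous elements up to degree `N` as soon as it contains the
components up to degree `N` of a set of generators. -/
theorem deg_le_of_adjoin_eq_top {B : Subalgebra k A.carrier} {s : Set A.carrier} {N : ℕ}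
    (hs : Algebra.adjoin k s = ⊤)
    (hB : ∀ x ∈ s, ∀ e, 1 ≤ e → e ≤ N → gradedProj A.deg e x ∈ B) {d : ℕ} (hd : d ≤ N)
    {y : A.carrier} (hy : y ∈ A.deg d) : y ∈ B := by
  have hzero : ∀ x, gradedProj A.deg 0 x ∈ B := fun x => by
    rw [A.eq_algebraMap_of_mem (gradedProj_mem A.deg 0 x)]
    exact B.algebraMap_mem _
  -- The generators need not be homogeneous, so the induction concerns all components up to `N`; a
  -- component of a product involves only components of the factors of no greater degree.
  have key : ∀ x, ∀ e ≤ N, gradedProj A.deg e x ∈ B := by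
    intro x
    have hx : x ∈ Algebra.adjoin k s := by
      rw [hs]
      trivial
    induction hx using Algebra.adjoin_induction with
    | mem x hx =>
      intro e he
      rcases Nat.eq_zero_or_pos e with rfl | h
      · exact hzero x
      · exact hB x hx e h he
    | algebraMap c =>
      intro e he
      have hc : algebraMap k A.carrier c ∈ A.deg 0 := SetLike.algebraMap_mem_graded A.deg c
      by_cases h : e = 0
      · subst h
        exact hzero _
      · rw [gradedProj_ne A.deg hc h]
        exact B.zero_mem
    | add a b _ _ ha hb =>
      intro e he
      rw [map_add]
      exact B.add_mem (ha e he) (hb e he)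
    | mul a b _ _ ha hb =>
      intro e he
      rw [gradedProj_mul]
      refine B.sum_mem fun ij hij => ?_
      have := Finset.HasAntidiagonal.mem_antidiagonal.1 hij
      exact B.mul_mem (ha _ (by omega)) (hb _ (by omega))
  rw [← gradedProj_same A.deg hy]
  exact key y d hd

/-- Above degree `N` exactness at 0 writes an element as a sum of products of elements of positive,
hence strictly smaller, degrees. -/
theorem deg_le_of_exactAt {B : Subalgebra k A.carrier} {N : ℕ}
    (hA : ∀ d : ℤ, (N : ℤ) < d → A.plusModule.ExactAt 0 d)
    (hB : ∀ d ≤ N, ∀ y ∈ A.deg d, y ∈ B) (d : ℕ) : ∀ y ∈ A.deg d, y ∈ B := by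
  induction d using Nat.strong_induction_on with
  | _ d ih =>
    intro y hy
    by_cases hd : d ≤ N
    · exact hB d hd y hy
    · have hyp : y ∈ A.plus := A.aug_of_mem (by omega) hy
      obtain ⟨t, ht, hty⟩ := hA d (by omega) (⟨y, hyp⟩ : A.plus) trivial hy
      have hty : (TensorProduct.lift A.plusMul t : A.plus) = ⟨y, hyp⟩ := hty
      have h : tensorDeg A.plusModule.deg A.plusDeg d ≤
          (B.toSubmodule.comap A.plus.subtype).comap (TensorProduct.lift A.plusMul) := by
        refine tensorDeg_le fun l a ha b hb => ?_
        rcases Nat.eq_zero_or_pos l with rfl | hl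
        · rw [A.plusDeg_zero, Submodule.mem_bot] at hb
          rw [hb, TensorProduct.tmul_zero]
          exact zero_mem _
        rcases le_or_gt d l with hdl | hdl
        · rw [A.plusModule_deg_eq_bot (by omega), Submodule.mem_bot] at ha
          rw [ha, TensorProduct.zero_tmul]
          exact zero_mem _
        · have e : (d : ℤ) - l = ((d - l : ℕ) : ℤ) := by omega
          rw [e] at ha
          exact B.mul_mem (ih (d - l) (by omega) _ ha) (ih l hdl _ hb)
      have : (TensorProduct.lift A.plusMul t : A.plus).1 ∈ B := h ht
      rw [hty] at this
      exact this

/-- All connected graded algebras with at most `n` generators that are generated in degrees up to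
`N` are quotients of one free algebra on finitely many letters. -/
theorem exists_universal_cover (k : Type u) [Field k] (n : ℤ) (N : ℕ) :
    ∃ T : ConnGradedAlgebra k, (∀ i, FiniteDimensional k (T.deg i)) ∧
      (∀ d : ℤ, (N : ℤ) < d → T.plusModule.ExactAt 0 d) ∧
      ∀ A : ConnGradedAlgebra k, A.GeneratedByAtMost n →
        (∀ d : ℤ, (N : ℤ) < d → A.plusModule.ExactAt 0 d) →
        ∃ φ : T.carrier →ₐ[k] A.carrier, IsGradedSurjection φ := by
  -- The letter `(i, j)` stands for the component of degree `j + 1` of the `i`-th generator.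
  let w : Fin n.toNat × Fin N → ℕ := fun x => x.2 + 1
  have hw : ∀ x, 1 ≤ w x := fun x => Nat.le_add_left 1 _
  refine ⟨freeGradedAlgebra k hw, freeGradedAlgebra.finiteDimensional_deg hw,
    fun d hd => freeGradedAlgebra.exactAt_zero hw (fun x => x.2.2) hd, ?_⟩
  rintro A ⟨s, hsn, hs⟩ hA
  -- If `A` has fewer generators than allowed, the default value sends the spare letters to 0.
  let f : Fin n.toNat × Fin N → A.carrier := fun x =>
    gradedProj A.deg (w x) (s.toList.getD x.1 0)
  have hf : ∀ x, f x ∈ A.deg (w x) := fun x => gradedProj_mem _ _ _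
  refine ⟨freeGradedAlgebra.lift hw f, freeGradedAlgebra.lift_mem hw hf, fun i y hy => ?_⟩
  refine exists_mem_of_mem_range (freeGradedAlgebra k hw).deg A.deg
    (f := (freeGradedAlgebra.lift hw f).toLinearMap) (freeGradedAlgebra.lift_mem hw hf) hy ?_
  refine deg_le_of_exactAt (B := (freeGradedAlgebra.lift hw f).range) hA
    (fun d hd y hy => deg_le_of_adjoin_eq_top hs ?_ hd hy) i y hy
  intro x hx e he heN
  obtain ⟨i, hi, rfl⟩ := List.mem_iff_getElem.1 (Finset.mem_toList.2 hx)
  have hlen := s.length_toList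
  have h := freeGradedAlgebra.mem_range_lift hw f (⟨i, by omega⟩, ⟨e - 1, by omega⟩)
  have he' : e - 1 + 1 = e := by omega
  simp only [f, w, he', List.getD_eq_getElem _ _ hi] at h
  exact h

end ConnGradedAlgebra

/-! ### Free graded modules and the universal cover of the modules -/

section ZExtend

variable {k X : Type*} [Field k] [AddCommGroup X] [Module k X] (W : ℕ → Submodule k X)

theorem zExtend_induction {motive : ℤ → X → Prop} {i : ℤ} {x : X}
    (hx : x ∈ zExtend W i) (zero : ∀ i, motive i 0) (nat : ∀ l : ℕ, ∀ x ∈ W l, motive l x) :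
    motive i x := by
  cases i with
  | ofNat l => exact nat l x hx
  | negSucc l =>
    have hx : x = 0 := hx
    rw [hx]
    exact zero _

theorem finiteDimensional_zExtend [∀ l, FiniteDimensional k (W l)] (i : ℤ) :
    FiniteDimensional k (zExtend W i) := by
  cases i with
  | ofNat l => exact inferInstanceAs (FiniteDimensional k (W l))
  | negSucc l => exact inferInstanceAs (FiniteDimensional k (⊥ : Submodule k X))

end ZExtend

namespace GradedRightModule

variable {k : Type u} [Field k] {T A : ConnGradedAlgebra k}

section FreeModule

variable {Y : Type} (T) (d : Y → ℤ)

/-- The homogeneous components of the free module with generators of given degrees. -/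
def freeDeg (i : ℤ) : Submodule k (Y → T.carrier) :=
  Submodule.pi Set.univ fun y => zExtend T.deg (i - d y)

theorem mem_freeDeg {i : ℤ} {f : Y → T.carrier} :
    f ∈ freeDeg T d i ↔ ∀ y, f y ∈ zExtend T.deg (i - d y) := by
  simp [freeDeg, Submodule.mem_pi]

variable [DecidableEq Y]

theorem single_mem_freeDeg {y : Y} {l : ℕ} {t : T.carrier} (ht : t ∈ T.deg l) :
    Pi.single y t ∈ freeDeg T d (d y + l) := by
  rw [mem_freeDeg]
  intro y'
  by_cases h : y' = y
  · subst h
    rw [Pi.single_eq_same, add_sub_cancel_left]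
    exact ht
  · rw [Pi.single_eq_of_ne h]
    exact zero_mem _

variable [Fintype Y]

theorem isInternal_freeDeg : DirectSum.IsInternal (freeDeg T d) := by
  refine isInternal_of_projections (freeDeg T d)
    (fun i => LinearMap.pi fun y => gradedProj (zExtend T.deg) (i - d y) ∘ₗ LinearMap.proj y)
    ?_ ?_ ?_
  · intro i f hf
    rw [mem_freeDeg] at hf
    funext y
    exact gradedProj_same _ (hf y)
  · intro i j h f hf
    rw [mem_freeDeg] at hf
    funext y
    exact gradedProj_ne _ (hf y) fun e => h (by omega)
  · intro f
    rw [← Finset.univ_sum_single f]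
    refine Submodule.sum_mem _ fun y _ => ?_
    have h : (⨆ l, T.deg l) ≤
        (⨆ i, freeDeg T d i).comap (LinearMap.single k (fun _ : Y => T.carrier) y) :=
      iSup_le fun l t ht => Submodule.mem_iSup_of_mem _ (single_mem_freeDeg T d ht)
    exact h (mem_iSup_of_decomposition T.deg (f y))

/-- The right action on tuples. -/
@[reducible]
def freeRightModule : Module (T.carrier)ᵐᵒᵖ (Y → T.carrier) := inferInstance

/-- The free right module with generators of given degrees. -/
def free : GradedRightModule T where
  carrier := Y → T.carrier
  rightModule := freeRightModule T
  isScalarTower := ⟨fun c a f => funext fun y => mul_smul_comm c (f y) a.unop⟩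
  deg := freeDeg T d
  decomposition := (isInternal_freeDeg T d).chooseDecomposition
  smul_mem := by
    intro i j f a hf ha
    rw [mem_freeDeg] at hf ⊢
    intro y
    have e : i + j - d y = (i - d y) + j := by ring
    rw [e]
    change f y * a ∈ _
    refine zExtend_induction T.deg (motive := fun i x => x * a ∈ zExtend T.deg (i + j)) (hf y)
      (fun i => ?_) fun l x hx =>
        SetLike.mul_mem_graded (A := T.deg) hx ha
    rw [zero_mul]
    exact zero_mem _

theorem free_deg_eq_bot {p : ℤ} (hp : ∀ y, p ≤ d y) : ∀ i < p, (free T d).deg i = ⊥ := by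
  intro i hi
  refine (Submodule.eq_bot_iff _).2 fun (f : Y → T.carrier) (hf : f ∈ freeDeg T d i) => ?_
  rw [mem_freeDeg] at hf
  refine funext fun y => ?_
  have := hf y
  rw [zExtend_of_neg _ (by have := hp y; omega)] at this
  exact this

theorem finiteDimensional_free_deg [∀ l, FiniteDimensional k (T.deg l)] (i : ℤ) :
    FiniteDimensional k ((free T d).deg i) := by
  have := finiteDimensional_zExtend T.deg
  let g : freeDeg T d i →ₗ[k] ∀ y, zExtend T.deg (i - d y) :=
    LinearMap.pi fun y => ((LinearMap.proj y : (Y → T.carrier) →ₗ[k] T.carrier) ∘ₗ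
      (freeDeg T d i).subtype).codRestrict _ fun f => (mem_freeDeg T d).1 f.2 y
  refine FiniteDimensional.of_injective g fun f f' h => Subtype.ext (funext fun y => ?_)
  exact congrArg Subtype.val (congrFun h y)

/-- In degree `i` above all generator degrees, every coordinate has positive degree and so lies in
`T₊`; acting by it on the basis vector recovers that part of the tuple. -/
theorem free_exactAt_zero {N : ℤ} (hN : ∀ y, d y ≤ N) {i : ℤ} (hi : N < i) :
    (free T d).ExactAt 0 i := by
  intro (f : Y → T.carrier) _ (hf : f ∈ freeDeg T d i)
  rw [mem_freeDeg] at hf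
  suffices h : ∀ y, (Pi.single y (f y) : Y → T.carrier) ∈
      ((free T d).barDeg 1 i).map ((free T d).barD 0) by
    have h' : ∑ y, (Pi.single y (f y) : Y → T.carrier) ∈
      ((free T d).barDeg 1 i).map ((free T d).barD 0) := Submodule.sum_mem _ fun y _ => h y
    rw [Finset.univ_sum_single f] at h'
    exact h'
  intro y
  have hy := hN y
  obtain ⟨l, hl⟩ := Int.eq_ofNat_of_zero_le (show 0 ≤ i - d y by omega)
  have hfy := hf y
  rw [hl] at hfy
  have hfy : f y ∈ T.deg l := hfy
  let a : T.plus := ⟨f y, T.aug_of_mem (by omega) hfy⟩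
  have h₁ : (Pi.single y 1 : Y → T.carrier) ∈ freeDeg T d (i - l) := by
    have := single_mem_freeDeg T d (y := y) (SetLike.one_mem_graded T.deg)
    have e : d y + (0 : ℕ) = i - l := by omega
    rwa [e] at this
  have h₂ : (Pi.single y 1 : Y → T.carrier) ⊗ₜ[k] a ∈ tensorDeg (freeDeg T d) T.plusDeg i :=
    tmul_mem_tensorDeg h₁ (show a ∈ T.plusDeg l from hfy)
  refine ⟨_, h₂, ?_⟩
  change (fun y' => (Pi.single y 1 : Y → T.carrier) y' * f y) = Pi.single y (f y)
  funext y'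
  by_cases h : y' = y
  · subst h
    simp
  · simp [Pi.single_eq_of_ne h]

variable {T d} {M : GradedRightModule A}

/-- The map from a free module with given values on the generators. -/
def freeLift (φ : T.carrier →ₐ[k] A.carrier) (x : Y → M.carrier) :
    (Y → T.carrier) →ₗ[k] M.carrier where
  toFun f := ∑ y, MulOpposite.op (φ (f y)) • x y
  map_add' f g := by
    simp only [Pi.add_apply, map_add, MulOpposite.op_add, add_smul, Finset.sum_add_distrib]
  map_smul' c f := by
    simp only [Pi.smul_apply, map_smul, MulOpposite.op_smul, smul_assoc, Finset.smul_sum,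
      RingHom.id_apply]

theorem freeLift_apply (φ : T.carrier →ₐ[k] A.carrier) (x : Y → M.carrier) (f : Y → T.carrier) :
    freeLift φ x f = ∑ y, MulOpposite.op (φ (f y)) • x y := rfl

theorem freeLift_mem {φ : T.carrier →ₐ[k] A.carrier}
    (hφ : ConnGradedAlgebra.IsGradedSurjection φ) {x : Y → M.carrier}
    (hx : ∀ y, x y ∈ M.deg (d y)) (i : ℤ) : ∀ f ∈ freeDeg T d i, freeLift φ x f ∈ M.deg i := by
  intro f hf
  rw [mem_freeDeg] at hf
  rw [freeLift_apply]
  refine Submodule.sum_mem _ fun y _ => ?_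
  have h := zExtend_induction T.deg
    (motive := fun i t => MulOpposite.op (φ t) • x y ∈ M.deg (d y + i)) (hf y) (fun i => ?_)
    fun l t ht => M.smul_mem _ l _ _ (hx y) (hφ.map_mem l t ht)
  · rwa [add_sub_cancel] at h
  · rw [map_zero, MulOpposite.op_zero, zero_smul]
    exact zero_mem _

theorem freeLift_op_smul (φ : T.carrier →ₐ[k] A.carrier) (x : Y → M.carrier) (f : Y → T.carrier)
    (a : T.carrier) :
    freeLift φ x (fun y => f y * a) = MulOpposite.op (φ a) • freeLift φ x f := by
  rw [freeLift_apply, freeLift_apply, Finset.smul_sum]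
  refine Finset.sum_congr rfl fun y _ => ?_
  rw [map_mul, MulOpposite.op_mul, mul_smul]

theorem span_le_range_freeLift {φ : T.carrier →ₐ[k] A.carrier}
    (hφ : ∀ a, ∃ t, φ t = a) (x : Y → M.carrier) {m : M.carrier}
    (hm : m ∈ Submodule.span (A.carrier)ᵐᵒᵖ (Set.range x)) :
    m ∈ LinearMap.range (freeLift φ x) := by
  induction hm using Submodule.span_induction with
  | mem m hm =>
    obtain ⟨y, rfl⟩ := hm
    refine ⟨Pi.single y 1, ?_⟩
    rw [freeLift_apply, Finset.sum_eq_single y]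
    · rw [Pi.single_eq_same, map_one, MulOpposite.op_one, one_smul]
    · intro y' _ h
      rw [Pi.single_eq_of_ne h, map_zero, MulOpposite.op_zero, zero_smul]
    · exact fun h => absurd (Finset.mem_univ y) h
  | zero => exact zero_mem _
  | add a b _ _ ha hb => exact add_mem ha hb
  | smul a m _ hm =>
    obtain ⟨f, rfl⟩ := hm
    obtain ⟨t, ht⟩ := hφ a.unop
    refine ⟨fun y => f y * t, ?_⟩
    rw [freeLift_op_smul, ht, MulOpposite.op_unop]

end FreeModule

variable {M : GradedRightModule A}

theorem gradedProj_op_smul {j : ℕ} {a : A.carrier} (ha : a ∈ A.deg j) (x : M.carrier) (e : ℤ) :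
    gradedProj M.deg e (MulOpposite.op a • x) =
      MulOpposite.op a • gradedProj M.deg (e - j) x := by
  induction x using DirectSum.Decomposition.inductionOn M.deg with
  | zero => simp
  | @homogeneous i x =>
    have hx := M.smul_mem i j x a x.2 ha
    by_cases h : e = i + j
    · subst h
      rw [gradedProj_same _ hx, add_sub_cancel_right, gradedProj_same _ x.2]
    · rw [gradedProj_ne _ hx h, gradedProj_ne _ x.2 (by omega), smul_zero]
  | add x y hx hy => rw [smul_add, map_add, map_add, hx, hy, smul_add]

/-- A submodule contains all homogeneous elements up to degree `N` as soon as it contains the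
components up to degree `N` of a set of generators. -/
theorem deg_le_of_span_eq_top {R : Submodule (A.carrier)ᵐᵒᵖ M.carrier} {s : Set M.carrier} {N : ℤ}
    (hs : Submodule.span (A.carrier)ᵐᵒᵖ s = ⊤)
    (hR : ∀ x ∈ s, ∀ e ≤ N, gradedProj M.deg e x ∈ R) {d : ℤ} (hd : d ≤ N)
    {y : M.carrier} (hy : y ∈ M.deg d) : y ∈ R := by
  have key : ∀ x, ∀ e ≤ N, gradedProj M.deg e x ∈ R := by
    intro x
    have hx : x ∈ Submodule.span (A.carrier)ᵐᵒᵖ s := by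
      rw [hs]
      trivial
    induction hx using Submodule.span_induction with
    | mem x hx => exact hR x hx
    | zero =>
      intro e _
      rw [map_zero]
      exact zero_mem _
    | add a b _ _ ha hb =>
      intro e he
      rw [map_add]
      exact add_mem (ha e he) (hb e he)
    | smul a x _ hx =>
      intro e he
      obtain ⟨a, rfl⟩ := MulOpposite.op_surjective a
      induction a using DirectSum.Decomposition.inductionOn A.deg with
      | zero =>
        rw [MulOpposite.op_zero, zero_smul, map_zero]
        exact zero_mem _
      | @homogeneous j a =>
        rw [gradedProj_op_smul a.2]
        exact R.smul_mem _ (hx _ (by omega))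
      | add a b ha hb =>
        rw [MulOpposite.op_add, add_smul, map_add]
        exact add_mem ha hb
  rw [← gradedProj_same M.deg hy]
  exact key y d hd

/-- A graded Nakayama argument: above `N` each component of `M` is obtained from strictly lower ones
by acting with `A₊`. -/
theorem deg_le_of_exactAt {R : Submodule (A.carrier)ᵐᵒᵖ M.carrier} {N : ℤ}
    (hM : ∀ d, N < d → M.ExactAt 0 d) (hR : ∀ d ≤ N, ∀ y ∈ M.deg d, y ∈ R) (d : ℤ) :
    ∀ y ∈ M.deg d, y ∈ R := by
  let R' : Submodule k M.carrier :=
    { R with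
      smul_mem' := fun c x hx => by
        rw [← smul_one_smul (A.carrier)ᵐᵒᵖ c x]
        exact R.smul_mem _ hx }
  have key : ∀ (e : ℕ) (d : ℤ), d ≤ N + e → ∀ y ∈ M.deg d, y ∈ R := by
    intro e
    induction e with
    | zero => exact fun d hd => hR d (by simpa using hd)
    | succ e ih =>
      intro d hd y hy
      by_cases hdN : d ≤ N
      · exact hR d hdN y hy
      · obtain ⟨t, ht, rfl⟩ := hM d (by omega) y trivial hy
        have h : tensorDeg M.deg A.plusDeg d ≤ R'.comap (TensorProduct.lift M.act) := by
          refine tensorDeg_le fun l x hx a ha => ?_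
          rcases Nat.eq_zero_or_pos l with rfl | hl
          · rw [A.plusDeg_zero, Submodule.mem_bot] at ha
            rw [ha, TensorProduct.tmul_zero]
            exact zero_mem _
          · exact R.smul_mem _ (ih (d - l) (by push_cast at hd; omega) x hx)
        exact h ht
  exact key (d - N).toNat d (by omega)

/-- All graded modules with at most `m` generators that vanish below degree `p` and are generated
in degrees up to `N`, over graded quotients of `T`, are quotients of one free `T`-module of finite
rank. -/
theorem exists_universal_cover (T : ConnGradedAlgebra k)
    (hT : ∀ i, FiniteDimensional k (T.deg i)) (m p N : ℤ) :
    ∃ F : GradedRightModule T, (∀ i, FiniteDimensional k (F.deg i)) ∧ (∀ i < p, F.deg i = ⊥) ∧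
      (∀ d, N < d → F.ExactAt 0 d) ∧
      ∀ (A : ConnGradedAlgebra k) (φ : T.carrier →ₐ[k] A.carrier)
        (hφ : ConnGradedAlgebra.IsGradedSurjection φ) (M : GradedRightModule A),
        M.GeneratedByAtMost m → (∀ i < p, M.deg i = ⊥) → (∀ d, N < d → M.ExactAt 0 d) →
        ∃ ψ : F.carrier →ₗ[k] M.carrier, BarCover F M ψ hφ.plusMap := by
  -- The basis vector `(i, j)` stands for the component of degree `p + j` of the `i`-th generator,
  -- so the degrees run from `p` to `N`.
  let d : Fin m.toNat × Fin (N + 1 - p).toNat → ℤ := fun y => p + (y.2 : ℕ)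
  refine ⟨free T d, finiteDimensional_free_deg T d, free_deg_eq_bot T d fun y => by simp [d],
    fun i hi => free_exactAt_zero T d (fun y => ?_) hi, ?_⟩
  · have := y.2.2
    simp only [d]
    omega
  rintro A φ hφ M ⟨s, hsm, hs⟩ hp hM
  let x : Fin m.toNat × Fin (N + 1 - p).toNat → M.carrier := fun y =>
    gradedProj M.deg (d y) (s.toList.getD y.1 0)
  have hx : ∀ y, x y ∈ M.deg (d y) := fun y => gradedProj_mem _ _ _
  have hsurj : ∀ a, ∃ t, φ t = a := by
    intro a
    induction a using DirectSum.Decomposition.inductionOn A.deg with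
    | zero => exact ⟨0, map_zero φ⟩
    | @homogeneous i a =>
      obtain ⟨t, -, ht⟩ := hφ.surj i a a.2
      exact ⟨t, ht⟩
    | add a b ha hb =>
      obtain ⟨t, rfl⟩ := ha
      obtain ⟨t', rfl⟩ := hb
      exact ⟨t + t', map_add φ t t'⟩
  have hdec : DirectSum.Decomposition (freeDeg T d) := (isInternal_freeDeg T d).chooseDecomposition
  refine ⟨freeLift φ x, hasGradedSection_of_surjective (freeDeg T d) M.deg _
    (freeLift_mem hφ hx) fun i y hy => ?_, hφ.hasGradedSection, ?_, hφ.barCover.map_mul⟩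
  · refine exists_mem_of_mem_range (freeDeg T d) M.deg (freeLift_mem hφ hx) hy
      (span_le_range_freeLift hsurj x ?_)
    refine deg_le_of_exactAt hM (fun i hi y hy => deg_le_of_span_eq_top hs ?_ hi hy) i y hy
    intro z hz e he
    by_cases hep : e < p
    · have : gradedProj M.deg e z ∈ M.deg e := gradedProj_mem _ _ _
      rw [hp e hep, Submodule.mem_bot] at this
      rw [this]
      exact zero_mem _
    · obtain ⟨i, hi, rfl⟩ := List.mem_iff_getElem.1 (Finset.mem_toList.2 hz)
      have hlen := s.length_toList
      refine Submodule.subset_span ⟨(⟨i, by omega⟩, ⟨(e - p).toNat, by omega⟩), ?_⟩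
      have he' : p + ((e - p).toNat : ℤ) = e := by omega
      simp only [x, d, he', List.getD_eq_getElem _ _ hi]
  · exact fun f a => freeLift_op_smul φ x f a.1

end GradedRightModule

/-! ### Reduction to finitely many regular functions and low-degree dimensions -/

theorem exists_finite_regularFamily_of_fintype {k P E ι : Type*} [Field k] [AddCommGroup E]
    [Module k E] [Finite ι] (H : ι → Submodule k E) [∀ i, FiniteDimensional k (H i)]
    (W : ι → P → Submodule k E) (hW : ∀ i z, W i z ≤ H i) :
    ∃ G : Set (P → k), G.Finite ∧
      ∀ S : Subalgebra k (P → k), G ⊆ S → ∀ i, RegularFamily S (W i) := by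
  choose G hG hG' using fun i => exists_finite_regularFamily (H i) (W i) (hW i)
  exact ⟨⋃ i, G i, Set.finite_iUnion hG,
    fun S hS i => hG' i S ((Set.subset_iUnion G i).trans hS)⟩

theorem finite_range_of_le {P ι : Type*} [Finite ι] (c : P → ι → ℕ) (b : ι → ℕ)
    (h : ∀ z i, c z i ≤ b i) : (Set.range c).Finite := by
  refine (Set.Finite.pi' fun i => Set.finite_Iic (b i)).subset ?_
  rintro _ ⟨z, rfl⟩ i
  exact h z i

section LinearMaps

variable {k X X' : Type*} [Field k] [AddCommGroup X] [Module k X] [AddCommGroup X'] [Module k X']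
  {ι : Type*} {V : ι → Submodule k X} {V' : ι → Submodule k X'} {f : X →ₗ[k] X'}

theorem HasGradedSection.finiteDimensional (h : HasGradedSection V V' f) (i : ι)
    [FiniteDimensional k (V i)] : FiniteDimensional k (V' i) := by
  rw [← h.map_eq]
  infer_instance

theorem HasGradedSection.finrank_le (h : HasGradedSection V V' f) (i : ι)
    [FiniteDimensional k (V i)] : Module.finrank k (V' i) ≤ Module.finrank k (V i) := by
  rw [← h.map_eq]
  exact Submodule.finrank_map_le f (V i)

end LinearMaps

namespace ConnGradedAlgebra

variable {k : Type u} [Field k]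

theorem map_plusDeg (A : ConnGradedAlgebra k) {i : ℕ} (hi : i ≠ 0) :
    (A.plusDeg i).map A.plus.subtype = A.deg i := by
  rw [plusDeg, Submodule.map_comap_subtype]
  exact inf_eq_right.2 fun x hx => A.aug_of_mem hi hx

theorem finrank_deg_zero (A : ConnGradedAlgebra k) : Module.finrank k (A.deg 0) = 1 := by
  rw [← Module.finrank_self k]
  exact (LinearEquiv.ofBijective (Algebra.linearMap k (A.deg 0)) A.connected).finrank_eq.symm

theorem finrank_deg (A : ConnGradedAlgebra k) {i : ℕ} (hi : i ≠ 0) :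
    Module.finrank k (A.deg i) = Module.finrank k (A.plusDeg i) := by
  rw [← A.map_plusDeg hi]
  exact Submodule.finrank_map_subtype_eq _ _

theorem finiteDimensional_plusDeg (A : ConnGradedAlgebra k) (i : ℕ)
    [FiniteDimensional k (A.deg i)] : FiniteDimensional k (A.plusDeg i) := by
  refine FiniteDimensional.of_injective
    (A.plus.subtype.restrict (p := A.plusDeg i) (q := A.deg i) fun x hx => hx) fun x y h => ?_
  exact Subtype.ext (Subtype.ext (congrArg (fun t : A.deg i => (t : A.carrier)) h))

/-- The bounds on `m_1`, `m_2`, `m_3` of the algebra give exactness for `A₊` at places 0, 1, 2.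
Raising the bound to a natural number is harmless. -/
theorem exactAt_plusModule_of_mem_classD {n a b c : ℤ} {A : ConnGradedAlgebra k}
    (hA : A ∈ classD k n a b c) {d : ℤ} (hd : (max a (max b c)).toNat < d) :
    A.plusModule.ExactAt 0 d ∧ A.plusModule.ExactAt 1 d ∧ A.plusModule.ExactAt 2 d := by
  obtain ⟨-, h₁, h₂, h₃⟩ := hA
  refine ⟨A.exactAt_plusModule (GradedRightModule.exactAt_of_m_le h₁ ?_),
    A.exactAt_plusModule (GradedRightModule.exactAt_of_m_le h₂ ?_),
    A.exactAt_plusModule (GradedRightModule.exactAt_of_m_le h₃ ?_)⟩ <;> omega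

/-- For a family of graded quotients of `T` with bar complexes exact above degree `N`, the
relations are regular and the dimensions constant on irreducible sets in all degrees, as soon as
finitely many functions are regular and the dimensions up to degree `N` are constant. -/
theorem exists_finite_regular_of_exactAt {P : Type*} {T : ConnGradedAlgebra k}
    [∀ i, FiniteDimensional k (T.deg i)] {N : ℕ}
    (hT : ∀ d : ℤ, (N : ℤ) < d → T.plusModule.ExactAt 0 d) (A : P → ConnGradedAlgebra k)
    (hA : ∀ z, ∀ d : ℤ, (N : ℤ) < d → (A z).plusModule.ExactAt 0 d ∧
      (A z).plusModule.ExactAt 1 d ∧ (A z).plusModule.ExactAt 2 d)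
    (φ : ∀ z, T.carrier →ₐ[k] (A z).carrier) (hφ : ∀ z, IsGradedSurjection (φ z)) :
    ∃ G : Set (P → k), G.Finite ∧ ∀ S : Subalgebra k (P → k), G ⊆ S →
      (∀ l, RegularFamily S fun z => LinearMap.ker (hφ z).plusMap ⊓ T.plusDeg l) ∧
      ∀ Z : Set P, IrreducibleFor S Z →
        (∀ i ≤ N, ∀ z ∈ Z, ∀ z' ∈ Z,
          Module.finrank k ((A z).plusDeg i) = Module.finrank k ((A z').plusDeg i)) →
        ∀ i, ∀ z ∈ Z, ∀ z' ∈ Z,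
          Module.finrank k ((A z).plusDeg i) = Module.finrank k ((A z').plusDeg i) := by
  have hTf : ∀ i, FiniteDimensional k (T.plusDeg i) := fun i => T.finiteDimensional_plusDeg i
  have hFf : ∀ i, FiniteDimensional k (T.plusModule.deg i) := finiteDimensional_zExtend T.plusDeg
  have hF : ∀ i < 1, T.plusModule.deg i = ⊥ := fun i hi => T.plusModule_deg_eq_bot hi
  obtain ⟨G, hG, hG'⟩ := exists_finite_regularFamily_of_fintype
    (fun l : Fin (N + 1) => T.plusDeg l)
    (fun (l : Fin (N + 1)) z => LinearMap.ker (hφ z).plusMap ⊓ T.plusDeg l)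
    fun l z => inf_le_right
  refine ⟨G, hG, fun S hS => ?_⟩
  have hJ : ∀ d : ℤ, RegularFamily S fun z =>
      LinearMap.ker (hφ z).plusMap ⊓ T.plusModule.deg d := by
    refine GradedRightModule.regularFamily_ker_of_le (N := N) (fun z => (hφ z).barCover) hF hT
      (fun z d hd => (hA z d hd).2.1) ?_ ?_
    · rintro (l | l) hl
      · exact hG' S hS ⟨l, by have : (l : ℤ) ≤ N := hl; omega⟩
      · exact (regularFamily_const (⊥ : Submodule k T.plus)).congr fun z => (inf_bot_eq _).symm
    -- Here `p = 1`, so `l ≤ d - p` means `l < d`, and the induction hypothesis is itself what is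
    -- needed for `T₊`.
    · exact fun d _ h l _ hl => h l (by omega)
  refine ⟨fun l => hJ l, fun Z hZ hN i => ?_⟩
  refine GradedRightModule.finrank_deg_eq_of_le (M := fun z => (A z).plusModule) (N := N)
    (fun z => (hφ z).barCover) hF hJ (fun l _ => hJ l) hA hZ ?_ ?_ (i : ℤ)
  · rintro (l | l) hl z hz z' hz'
    · exact hN l (by have : (l : ℤ) ≤ N := hl; omega) z hz z' hz'
    · change Module.finrank k (⊥ : Submodule k (A z).plus) =
        Module.finrank k (⊥ : Submodule k (A z').plus)
      rw [finrank_bot, finrank_bot]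
  · exact fun d _ h l _ hl => h l (by omega)

end ConnGradedAlgebra

namespace GradedRightModule

variable {k : Type u} [Field k]

theorem exactAt_of_mem_classDM {n a b c m p₁ p₂ q r : ℤ}
    {X : Σ A : ConnGradedAlgebra k, GradedRightModule A}
    (hX : X ∈ classDM k n a b c m p₁ p₂ q r) {d : ℤ} (hd : max p₂ (max q r) < d) :
    X.2.ExactAt 0 d ∧ X.2.ExactAt 1 d ∧ X.2.ExactAt 2 d := by
  obtain ⟨-, -, -, h₁, h₂, h₃⟩ := hX
  refine ⟨exactAt_of_m_le h₁ ?_, exactAt_of_m_le h₂ ?_, exactAt_of_m_le h₃ ?_⟩ <;> omega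

/-- For a family of graded quotients of `F` with bar complexes exact above degree `N`, the
dimensions are constant on irreducible sets in all degrees, as soon as finitely many functions are
regular, the relations of the algebras are regular, and the dimensions of the algebras and those
of the modules up to degree `N` are constant. -/
theorem exists_finite_regular_of_exactAt {P : Type*} {T : ConnGradedAlgebra k}
    [∀ i, FiniteDimensional k (T.plusDeg i)] {F : GradedRightModule T}
    [∀ i, FiniteDimensional k (F.deg i)] {p N : ℤ} (hp : ∀ i < p, F.deg i = ⊥)
    (hF : ∀ d : ℤ, N < d → F.ExactAt 0 d) {A : P → ConnGradedAlgebra k}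
    (M : ∀ z, GradedRightModule (A z))
    (hM : ∀ z, ∀ d : ℤ, N < d → (M z).ExactAt 0 d ∧ (M z).ExactAt 1 d ∧ (M z).ExactAt 2 d)
    (α : ∀ z, F.carrier →ₗ[k] (M z).carrier) (β : ∀ z, T.plus →ₗ[k] (A z).plus)
    (h : ∀ z, BarCover F (M z) (α z) (β z)) :
    ∃ G : Set (P → k), G.Finite ∧ ∀ S : Subalgebra k (P → k), G ⊆ S →
      (∀ l, RegularFamily S fun z => LinearMap.ker (β z) ⊓ T.plusDeg l) →
      ∀ Z : Set P, IrreducibleFor S Z →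
        (∀ l, ∀ z ∈ Z, ∀ z' ∈ Z,
          Module.finrank k ((A z).plusDeg l) = Module.finrank k ((A z').plusDeg l)) →
        (∀ i, p ≤ i → i ≤ N → ∀ z ∈ Z, ∀ z' ∈ Z,
          Module.finrank k ((M z).deg i) = Module.finrank k ((M z').deg i)) →
        ∀ i, ∀ z ∈ Z, ∀ z' ∈ Z,
          Module.finrank k ((M z).deg i) = Module.finrank k ((M z').deg i) := by
  obtain ⟨G, hG, hG'⟩ := exists_finite_regularFamily_of_fintype
    (fun i : Set.Icc p N => F.deg i)
    (fun (i : Set.Icc p N) z => LinearMap.ker (α z) ⊓ F.deg i) fun i z => inf_le_right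
  refine ⟨G, hG, fun S hS hI Z hZ hdA hdM => ?_⟩
  have hJ : ∀ d : ℤ, RegularFamily S fun z => LinearMap.ker (α z) ⊓ F.deg d := by
    refine regularFamily_ker_of_le h hp hF (fun z d hd => (hM z d hd).2.1) (fun d hd => ?_)
      fun d _ _ l _ _ => hI l
    by_cases hdp : d < p
    · simp only [hp d hdp, inf_bot_eq]
      exact regularFamily_const _
    · exact hG' S hS ⟨d, by omega, hd⟩
  refine finrank_deg_eq_of_le h hp hJ (fun l _ => hI l) hM hZ (fun i hi z hz z' hz' => ?_)
    fun d _ _ l _ _ => hdA l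
  by_cases hip : i < p
  · have hbot : ∀ z, (M z).deg i = ⊥ := fun z => by
      rw [← (h z).section_module.map_eq, hp i hip, Submodule.map_bot]
    rw [hbot, hbot, finrank_bot, finrank_bot]
  · exact hdM i (by omega) hi z hz z' hz'

end GradedRightModule

/-! ### Finiteness of the sets of Hilbert series -/

theorem finiteDimensional_deg_and_finite_hilbertSeries_classD (k : Type u) [Field k]
    (n a b c : ℤ) :
    (∀ A ∈ classD k n a b c, ∀ i : ℕ, FiniteDimensional k (A.deg i)) ∧
      {h : PowerSeries ℤ | ∃ A ∈ classD k n a b c, h = A.hilbertSeries}.Finite := by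
  set N := (max a (max b c)).toNat
  obtain ⟨T, hTf, hT, hcov⟩ := ConnGradedAlgebra.exists_universal_cover k n N
  have hA : ∀ A ∈ classD k n a b c, ∀ d : ℤ, (N : ℤ) < d → A.plusModule.ExactAt 0 d ∧
      A.plusModule.ExactAt 1 d ∧ A.plusModule.ExactAt 2 d := fun A hA d hd =>
    ConnGradedAlgebra.exactAt_plusModule_of_mem_classD hA hd
  have hφ : ∀ z : classD k n a b c, ∃ φ : T.carrier →ₐ[k] z.1.carrier,
      ConnGradedAlgebra.IsGradedSurjection φ := fun z =>
    hcov z.1 z.2.1 fun d hd => (hA z.1 z.2 d hd).1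
  choose φ hφ using hφ
  have hTf' : ∀ i, FiniteDimensional k (T.plusDeg i) := fun i => T.finiteDimensional_plusDeg i
  constructor
  · intro A hA i
    have h : (T.deg i).map (φ ⟨A, hA⟩).toLinearMap = A.deg i := by
      apply le_antisymm
      · rintro _ ⟨x, hx, rfl⟩
        exact (hφ ⟨A, hA⟩).map_mem i x hx
      · exact fun y hy => (hφ ⟨A, hA⟩).surj i y hy
    rw [← h]
    infer_instance
  · obtain ⟨G, hG, hG'⟩ := ConnGradedAlgebra.exists_finite_regular_of_exactAt hT
      (fun z : classD k n a b c => z.1) (fun z => hA z.1 z.2) φ hφ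
    -- The parameter set is the class itself. The function with finitely many values records the
    -- dimensions up to degree `N`, which are bounded by those of `T`.
    have hfin := finite_range_of_irreducibleFor (S := Algebra.adjoin k G)
      (Subalgebra.fg_def.2 ⟨G, hG, rfl⟩)
      (fun (z : classD k n a b c) (i : Fin (N + 1)) => Module.finrank k (z.1.plusDeg i))
      (finite_range_of_le _ (fun i => Module.finrank k (T.plusDeg i))
        fun z i => (hφ z).hasGradedSection.finrank_le _)
      (fun z => z.1.hilbertSeries) (by
        intro Z hZ hc z hz z' hz'
        have h := (hG' _ Algebra.subset_adjoin).2 Z hZ fun i hi z hz z' hz' =>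
          congrFun (hc z hz z' hz') ⟨i, by omega⟩
        ext i
        simp only [ConnGradedAlgebra.hilbertSeries, PowerSeries.coeff_mk]
        -- Degree 0 is invisible to `A₊`; there connectedness fixes the dimension as 1.
        by_cases hi : i = 0
        · rw [hi, ConnGradedAlgebra.finrank_deg_zero, ConnGradedAlgebra.finrank_deg_zero]
        · rw [ConnGradedAlgebra.finrank_deg _ hi, ConnGradedAlgebra.finrank_deg _ hi,
            h i z hz z' hz'])
    refine hfin.subset ?_
    rintro _ ⟨A, hA, rfl⟩
    exact ⟨⟨A, hA⟩, rfl⟩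

theorem finiteDimensional_deg_and_finite_hilbertSeries_classDM (k : Type u) [Field k]
    (n a b c m p₁ p₂ q r : ℤ) :
    (∀ X ∈ classDM k n a b c m p₁ p₂ q r, ∀ i : ℤ, FiniteDimensional k (X.2.deg i)) ∧
      {h : ℤ → ℤ | ∃ X ∈ classDM k n a b c m p₁ p₂ q r, h = X.2.hilbertSeries}.Finite := by
  set N := (max a (max b c)).toNat
  set N' := max p₂ (max q r)
  obtain ⟨T, hTf, hT, hcov⟩ := ConnGradedAlgebra.exists_universal_cover k n N
  obtain ⟨F, hFf, hFp, hF, hFcov⟩ := GradedRightModule.exists_universal_cover T hTf m p₁ N'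
  have hTf' : ∀ i, FiniteDimensional k (T.plusDeg i) := fun i => T.finiteDimensional_plusDeg i
  have hA : ∀ z : classDM k n a b c m p₁ p₂ q r, ∀ d : ℤ, (N : ℤ) < d →
      z.1.1.plusModule.ExactAt 0 d ∧ z.1.1.plusModule.ExactAt 1 d ∧
        z.1.1.plusModule.ExactAt 2 d := fun z d hd =>
    ConnGradedAlgebra.exactAt_plusModule_of_mem_classD z.2.1 hd
  have hM : ∀ z : classDM k n a b c m p₁ p₂ q r, ∀ d : ℤ, N' < d →
      z.1.2.ExactAt 0 d ∧ z.1.2.ExactAt 1 d ∧ z.1.2.ExactAt 2 d := fun z d hd =>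
    GradedRightModule.exactAt_of_mem_classDM z.2 hd
  have hφ : ∀ z : classDM k n a b c m p₁ p₂ q r, ∃ φ : T.carrier →ₐ[k] z.1.1.carrier,
      ConnGradedAlgebra.IsGradedSurjection φ := fun z =>
    hcov z.1.1 z.2.1.1 fun d hd => (hA z d hd).1
  choose φ hφ using hφ
  have hψ : ∀ z : classDM k n a b c m p₁ p₂ q r, ∃ ψ : F.carrier →ₗ[k] z.1.2.carrier,
      GradedRightModule.BarCover F z.1.2 ψ (hφ z).plusMap := fun z =>
    hFcov z.1.1 (φ z) (hφ z) z.1.2 z.2.2.1 z.2.2.2.1 fun d hd => (hM z d hd).1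
  choose ψ hψ using hψ
  constructor
  · exact fun X hX i => (hψ ⟨X, hX⟩).section_module.finiteDimensional i
  · obtain ⟨G, hG, hG'⟩ := ConnGradedAlgebra.exists_finite_regular_of_exactAt hT
      (fun z : classDM k n a b c m p₁ p₂ q r => z.1.1) hA φ hφ
    obtain ⟨G₂, hG₂, hG₂'⟩ := GradedRightModule.exists_finite_regular_of_exactAt hFp hF
      (fun z : classDM k n a b c m p₁ p₂ q r => z.1.2) hM ψ (fun z => (hφ z).plusMap) hψ
    -- One algebra of functions makes both the algebra relations and the module relations regular,
    -- and irreducibility refers to it. On such a set the algebra dimensions become constant in all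
    -- degrees before the modules are treated.
    have hfin := finite_range_of_irreducibleFor (S := Algebra.adjoin k (G ∪ G₂))
      (Subalgebra.fg_def.2 ⟨G ∪ G₂, hG.union hG₂, rfl⟩)
      (fun (z : classDM k n a b c m p₁ p₂ q r) (i : Fin (N + 1) ⊕ Set.Icc p₁ N') =>
        Sum.elim (fun i : Fin (N + 1) => Module.finrank k (z.1.1.plusDeg i))
          (fun i : Set.Icc p₁ N' => Module.finrank k (z.1.2.deg i)) i)
      (finite_range_of_le _ (Sum.elim (fun i => Module.finrank k (T.plusDeg i))
          fun i => Module.finrank k (F.deg i)) (by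
        rintro z (i | i)
        · exact (hφ z).hasGradedSection.finrank_le _
        · exact (hψ z).section_module.finrank_le _))
      (fun z => z.1.2.hilbertSeries) (by
        intro Z hZ hc z hz z' hz'
        obtain ⟨hI, hdA⟩ := hG' _ (Set.subset_union_left.trans Algebra.subset_adjoin)
        have h := hG₂' _ (Set.subset_union_right.trans Algebra.subset_adjoin) hI Z hZ
          (hdA Z hZ fun i hi z hz z' hz' => congrFun (hc z hz z' hz') (Sum.inl ⟨i, by omega⟩))
          (fun i hi hi' z hz z' hz' => congrFun (hc z hz z' hz') (Sum.inr ⟨i, hi, hi'⟩))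
        funext i
        simp only [GradedRightModule.hilbertSeries, h i z hz z' hz'])
    refine hfin.subset ?_
    rintro _ ⟨X, hX, rfl⟩
    exact ⟨⟨X, hX⟩, rfl⟩

end

theorem theorem2p3 (k : Type u) [Field k] (n a b c m p₁ p₂ q r : ℤ) :
    ((∀ A ∈ classD k n a b c, ∀ i : ℕ, FiniteDimensional k (A.deg i)) ∧
      {h : PowerSeries ℤ | ∃ A ∈ classD k n a b c, h = A.hilbertSeries}.Finite) ∧
    ((∀ X ∈ classDM k n a b c m p₁ p₂ q r, ∀ i : ℤ, FiniteDimensional k (X.2.deg i)) ∧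
      {h : ℤ → ℤ | ∃ X ∈ classDM k n a b c m p₁ p₂ q r, h = X.2.hilbertSeries}.Finite) :=
  ⟨finiteDimensional_deg_and_finite_hilbertSeries_classD k n a b c,
    finiteDimensional_deg_and_finite_hilbertSeries_classDM k n a b c m p₁ p₂ q r⟩
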